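/- **Setting.** Let $K$ be a field, $Q$ a finite quiver, and $\mathcal P$ its path algebra over $K$; the product of paths is concatenation from left to right. The paths are the *monomials* of $\mathcal P$; $\deg$ is path length and $1_v$ is the trivial path at the vertex $v$. Let $\psi\colon\mathcal P\to\mathcal A$ be a surjective homomorphism of $K$-algebras presenting a *basic algebra*: all monomials occurring in elements of $\ker\psi$ have degree at least $2$, and all sufficiently long paths lie in $\ker\psi$ (so $\mathcal A$ is finite-dimensional and its radical is generated by the images of the arrows). *Orderings.* A monomial ordering on $\mathcal P$ is a total ordering of its monomials such that $b_1>b_2$ implies $b_1b>b_2b$ and $b'b_1>b'b_2$ whenever these four products are nonzero. The leading monomial $\mathrm{LM}$ of a nonzero element is the greatest monomial occurring in it. Fix such an ordering. The *standard* monomials are those that are not leading monomials of elements of $\ker\psi$. Their images form a $K$-basis of $\mathcal A$ whenever the ordering is a negative degree ordering (greater degree means smaller), and are called the monomials of $\mathcal A$; the lift $\lambda(b)$ is the standard monomial with $\psi(\lambda(b))=b$, and monomials of $\mathcal A$ are ordered as their lifts. For monomials $b,c$ of $\mathcal A$, $c$ is a *small cofactor* of $b$ if $bc\neq0$ and $\lambda(b)$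 is an initial segment of the path $\lambda(\mathrm{LM}(bc))$. Let $F=\mathcal A^r$ be the free right module with basis $\mathfrak v_1,\dots,\mathfrak v_r$, with monomials $\mathfrak v_ib$ ($b$ a monomial of $\mathcal A$), totally ordered such that $b_1>b_2$ implies $\mathfrak v_ib_1>\mathfrak v_ib_2$, and such that $\mathfrak v_ib_1>\mathfrak v_jb_2$ implies $\mathfrak v_ib_1b>\mathfrak v_j\mathrm{LM}(b_2b)$ for every monomial $b$ of $\mathcal A$ for which $\lambda(b_1)\lambda(b)$ is a standard monomial and $b_2b\ne0$. Let $M\subseteq F$ be the submodule generated by $\hat g_1,\dots,\hat g_m$. Let $E=\mathcal P^m$ be the free right $\mathcal P$-module with basis $\mathfrak e_1,\dots,\mathfrak e_m$ and $ev\colon E\to M$, $ev(\mathfrak e_ip)=\hat g_i\psi(p)$. Its monomials $\mathfrak e_ip$ ($p$ a path, $\deg(\mathfrak e_ip)=\deg p$) are totally ordered such that $b_1>b_2$ implies $\mathfrak e_ib_1>\mathfrak e_ib_2$, and such that $\mathfrak e_ib_1>\mathfrak e_jb_2$ implies $\mathfrak e_ib_1b>\mathfrak e_jb_2b$ if $b_1b$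 and $b_2b$ are nonzero. Assume that this is a *negative degree ordering*: monomials of $E$ of greater degree are smaller. *Signed standard bases.* A signed element of $M\setminus\{0\}$ is a pair $g=(\mathrm{poly}(g),\sigma(g))$ with $0\ne\mathrm{poly}(g)\in M$ and $\sigma(g)$ a monomial of $E$ (the signature) such that $\sigma(g)=\mathrm{LM}(\tilde f)$ and $\mathrm{poly}(g)=ev(\tilde f)$ for some $\tilde f\in E$; write $\mathrm{LM}(g)=\mathrm{LM}(\mathrm{poly}(g))$. For $0\ne f\in F$ and a monomial $s$ of $E$, $f$ is (weakly) $s$-reducible with respect to a set $G$ of signed elements if there are $g\in G$ and a small cofactor $c$ of $\mathrm{LM}(g)$ with $\mathrm{LM}(g)c=\mathrm{LM}(f)$, $\sigma(g)\lambda(c)\neq0$ and $\sigma(g)\lambda(c)<s$ (resp. $\le s$). (For $\mathrm{LM}(g)=\mathfrak v_ib$, a small cofactor of $\mathrm{LM}(g)$ is one of $b$.) A finite set $G$ of signed elements of $M\setminus\{0\}$ is a *signed standard basis* of $M$ if every signed element $f$ of $M\setminus\{0\}$ such that $\mathrm{poly}(f)$ is not $\sigma(f)$-reducible with respect to the set of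 all signed elements of $M\setminus\{0\}$ has $\mathrm{poly}(f)$ weakly $\sigma(f)$-reducible with respect to $G$. It is *interreduced* if for every $g\in G$, $\mathrm{poly}(g)$ is not $\sigma(g)$-reducible with respect to $G$ and there are no $g'\in G\setminus\{g\}$ and small cofactor $c$ of $\mathrm{LM}(g')$ with $\mathrm{LM}(g')c=\mathrm{LM}(g)$ and $\sigma(g')\lambda(c)=\sigma(g)$. **Corollary.** Let $G$ be an interreduced signed standard basis of $M$ and $G_0=\{g\in G:\deg\sigma(g)=0\}$. Then the elements $\mathrm{poly}(g)$, $g\in G_0$, form a minimal generating set of the right $\mathcal A$-module $M$ in the following sense: they generate $M$, and their classes (indexed by $g\in G_0$) form a $K$-basis of the head $M/\mathrm{Rad}(M)$, where $\mathrm{Rad}(M)$ is the intersection of all maximal submodules of $M$. If moreover each $\mathrm{poly}(g)$, $g\in G_0$, is uniform (i.e. $\mathrm{poly}(g)\,1_v=\mathrm{poly}(g)$ for some vertex $v$, which is automatic if $Q$ has a single vertex), then no proper subset of $\{\mathrm{poly}(g):g\in G_0\}$ generates $M$. -/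

import Mathlib

noncomputable section

namespace SignedStd

/-! ### Path algebras -/

/-- A monomial of the path algebra: a directed path of the quiver `V`, with its endpoints. -/
structure PathMon (V : Type*) [Quiver V] where
  src : V
  tgt : V
  path : Quiver.Path src tgt

namespace PathMon

variable {V : Type*} [Quiver V]

/-- The degree of a monomial is the length of the path. -/
def deg (p : PathMon V) : ℕ := p.path.length

/-- The trivial path at the vertex `v`. -/
def triv (v : V) : PathMon V := ⟨v, v, Quiver.Path.nil⟩

open Classical in
/-- Concatenation of paths, first `p` and then `q`; `none` (the product is zero) if `p` does not
end where `q` starts. -/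
def comp (p q : PathMon V) : Option (PathMon V) :=
  if h : p.tgt = q.src then some ⟨p.src, q.tgt, p.path.comp (q.path.cast h.symm rfl)⟩ else none

/-- `b ∣ c`: the path `b` is an initial segment of the path `c`. -/
def Divides (b c : PathMon V) : Prop := ∃ d, comp b d = some c

theorem comp_assoc (p q r : PathMon V) :
    (comp p q).bind (fun u => comp u r) = (comp q r).bind (fun w => comp p w) := by
  obtain ⟨a, b, p⟩ := p
  obtain ⟨c, d, q⟩ := q
  obtain ⟨e, f, r⟩ := r
  by_cases h1 : b = c
  · subst h1
    by_cases h2 : d = e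
    · subst h2
      simp [comp, Quiver.Path.comp_assoc]
    · simp [comp, h2]
  · by_cases h2 : d = e
    · subst h2
      simp [comp, h1]
    · simp [comp, h1, h2]

theorem triv_comp (v : V) (p : PathMon V) [Decidable (v = p.src)] :
    comp (triv v) p = if v = p.src then some p else none := by
  obtain ⟨a, b, p⟩ := p
  by_cases h : v = a
  · subst h
    simp [comp, triv]
  · simp [comp, triv, h]

theorem comp_triv (v : V) (p : PathMon V) [Decidable (v = p.tgt)] :
    comp p (triv v) = if v = p.tgt then some p else none := by
  obtain ⟨a, b, p⟩ := p
  by_cases h : v = b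
  · subst h
    simp [comp, triv]
  · simp [comp, triv, h, Ne.symm h]

end PathMon

/-- The path algebra over `K` of the quiver `V`: formal `K`-linear combinations of paths. -/
def PathAlgebra (K V : Type*) [Field K] [Quiver V] := PathMon V →₀ K

namespace PathAlgebra

variable {K V : Type*} [Field K] [Quiver V]

instance : AddCommGroup (PathAlgebra K V) := inferInstanceAs (AddCommGroup (PathMon V →₀ K))

instance : Module K (PathAlgebra K V) := inferInstanceAs (Module K (PathMon V →₀ K))

/-- The coefficient of a path in an element of the path algebra. -/
def coeff (x : PathAlgebra K V) (p : PathMon V) : K := (show PathMon V →₀ K from x) p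

variable (K) in
/-- A path as an element of the path algebra. -/
def mon (p : PathMon V) : PathAlgebra K V := (Finsupp.single p 1 : PathMon V →₀ K)

variable (K) in
/-- The product of two paths in the path algebra: their concatenation, or zero. -/
def monMul (p q : PathMon V) : PathAlgebra K V := (PathMon.comp p q).elim 0 (mon K)

/-- Multiplication is the bilinear extension of concatenation of paths. -/
def mulHom : PathAlgebra K V →ₗ[K] PathAlgebra K V →ₗ[K] PathAlgebra K V :=
  Finsupp.linearCombination K (fun p : PathMon V =>
    (Finsupp.linearCombination K (fun q : PathMon V => monMul K p q) :
      (PathMon V →₀ K) →ₗ[K] PathAlgebra K V))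

instance : Mul (PathAlgebra K V) := ⟨fun x y => mulHom x y⟩

theorem mon_mul_mon (p q : PathMon V) : mon K p * mon K q = monMul K p q := by
  change (Finsupp.linearCombination K (fun p : PathMon V =>
    (Finsupp.linearCombination K (fun q : PathMon V => monMul K p q) :
      (PathMon V →₀ K) →ₗ[K] PathAlgebra K V)) (Finsupp.single p 1)) (Finsupp.single q 1) = _
  simp [Finsupp.linearCombination_single]

theorem hom_ext {N : Type*} [AddCommGroup N] [Module K N] {f g : PathAlgebra K V →ₗ[K] N}
    (h : ∀ p, f (mon K p) = g (mon K p)) : f = g :=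
  Finsupp.lhom_ext' (fun p => LinearMap.ext_ring (h p))

theorem assoc_aux (x y z : PathAlgebra K V) : mulHom (mulHom x y) z = mulHom x (mulHom y z) := by
  have h : (LinearMap.llcomp K (PathAlgebra K V) _ _ (mulHom (K := K) (V := V))).comp mulHom
      = ((LinearMap.lcomp K (PathAlgebra K V →ₗ[K] PathAlgebra K V) (mulHom (K := K) (V := V)))).comp
        ((LinearMap.llcomp K (PathAlgebra K V) _ _).comp mulHom) := by
    refine hom_ext fun p => hom_ext fun q => hom_ext fun r => ?_
    change (mon K p * mon K q) * mon K r = mon K p * (mon K q * mon K r)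
    have h := PathMon.comp_assoc p q r
    rw [mon_mul_mon, mon_mul_mon]
    unfold monMul
    cases h1 : PathMon.comp p q with
    | none =>
      cases h2 : PathMon.comp q r with
      | none =>
        change mulHom (0 : PathAlgebra K V) _ = mulHom _ (0 : PathAlgebra K V)
        simp
      | some w =>
        rw [h1, h2] at h
        have h3 : PathMon.comp p w = none := h.symm
        change mulHom (0 : PathAlgebra K V) _ = mon K p * mon K w
        rw [mon_mul_mon]
        simp [monMul, h3]
    | some u =>
      cases h2 : PathMon.comp q r with
      | none =>
        rw [h1, h2] at h
        have h3 : PathMon.comp u r = none := h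
        change mon K u * mon K r = mulHom _ (0 : PathAlgebra K V)
        rw [mon_mul_mon]
        simp [monMul, h3]
      | some w =>
        rw [h1, h2] at h
        have h3 : PathMon.comp u r = PathMon.comp p w := h
        change mon K u * mon K r = mon K p * mon K w
        rw [mon_mul_mon, mon_mul_mon]
        simp [monMul, h3]
  exact LinearMap.congr_fun (LinearMap.congr_fun (LinearMap.congr_fun h x) y) z

variable [Fintype V]

/-- The unit is the sum of the trivial paths. -/
instance : One (PathAlgebra K V) := ⟨∑ v, mon K (PathMon.triv v)⟩

open Classical in
theorem one_mul_aux (x : PathAlgebra K V) : mulHom 1 x = x := by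
  have h : mulHom (1 : PathAlgebra K V) = LinearMap.id := by
    refine hom_ext fun p => ?_
    change mulHom (∑ v, mon K (PathMon.triv v)) (mon K p) = mon K p
    rw [map_sum, LinearMap.sum_apply, Finset.sum_eq_single p.src]
    · change mon K _ * mon K p = _
      rw [mon_mul_mon]
      simp [monMul, PathMon.triv_comp]
    · intro v _ hv
      change mon K _ * mon K p = _
      rw [mon_mul_mon]
      simp [monMul, PathMon.triv_comp, hv]
    · simp
  exact LinearMap.congr_fun h x

open Classical in
theorem mul_one_aux (x : PathAlgebra K V) : mulHom x 1 = x := by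
  have h : mulHom.flip (1 : PathAlgebra K V) = LinearMap.id := by
    refine hom_ext fun p => ?_
    change mulHom (mon K p) (∑ v, mon K (PathMon.triv v)) = mon K p
    rw [map_sum, Finset.sum_eq_single p.tgt]
    · change mon K p * mon K _ = _
      rw [mon_mul_mon]
      simp [monMul, PathMon.comp_triv]
    · intro v _ hv
      change mon K p * mon K _ = _
      rw [mon_mul_mon]
      simp [monMul, PathMon.comp_triv, hv]
    · simp
  exact LinearMap.congr_fun h x

instance : Ring (PathAlgebra K V) where
  __ := (inferInstance : AddCommGroup (PathAlgebra K V))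
  mul_assoc := assoc_aux
  one_mul := one_mul_aux
  mul_one := mul_one_aux
  left_distrib x y z := (mulHom x).map_add y z
  right_distrib x y z := LinearMap.map_add₂ mulHom x y z
  zero_mul x := LinearMap.map_zero₂ mulHom x
  mul_zero x := (mulHom x).map_zero

instance : Algebra K (PathAlgebra K V) :=
  Algebra.ofModule (fun c x y => LinearMap.map_smul₂ mulHom c x y)
    (fun c x y => (mulHom x).map_smul c y)

end PathAlgebra

/-! ### Leading monomials -/

/-- `s` is the leading index of the coefficient family `c`: its coefficient is nonzero, and it is
the greatest such index (`lt a b` means `a < b`). In particular `c` is not zero. -/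
def IsLeading {ι K : Type*} [Zero K] (lt : ι → ι → Prop) (c : ι → K) (s : ι) : Prop :=
  c s ≠ 0 ∧ ∀ t, c t ≠ 0 → t = s ∨ lt t s

variable {K V : Type*} [Field K] [Quiver V]

/-- A monomial ordering of the path algebra. -/
structure IsMonomialOrder (lt : PathMon V → PathMon V → Prop) : Prop where
  total : IsStrictTotalOrder (PathMon V) lt
  mul : ∀ b₁ b₂ b b' u₁ u₂ w₁ w₂, lt b₂ b₁ →
    PathMon.comp b₁ b = some u₁ → PathMon.comp b₂ b = some u₂ →
    PathMon.comp b' b₁ = some w₁ → PathMon.comp b' b₂ = some w₂ → lt u₂ u₁ ∧ lt w₂ w₁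

variable [Fintype V] {A : Type*} [Ring A] [Algebra K A]

/-- `ψ` presents `A` as a basic algebra: the relations are at least quadratic, and all
sufficiently long paths are relations (so that, for a finite quiver, `A` is finite-dimensional
and the arrows generate its radical). -/
structure IsBasicPresentation (ψ : PathAlgebra K V →ₐ[K] A) : Prop where
  surjective : Function.Surjective ψ
  quadratic : ∀ x, ψ x = 0 → ∀ p, x.coeff p ≠ 0 → 2 ≤ p.deg
  long_paths : ∃ N : ℕ, ∀ p : PathMon V, N ≤ p.deg → ψ (PathAlgebra.mon K p) = 0

section Quotient

variable (lt : PathMon V → PathMon V → Prop) (ψ : PathAlgebra K V →ₐ[K] A)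

/-- Standard monomials: the monomials that are not leading monomials of elements of `ker ψ`. -/
def IsStandard (b : PathMon V) : Prop := ∀ x, ψ x = 0 → ¬ IsLeading lt x.coeff b

/-- The monomials of `A`, represented by their lifts, the standard monomials. -/
def StdMon : Type _ := {b : PathMon V // IsStandard lt ψ b}

variable {lt}

/-- The lift of a monomial of `A` to a path. -/
def StdMon.lift {ψ : PathAlgebra K V →ₐ[K] A} (b : StdMon lt ψ) : PathMon V := b.1

/-- The monomial as an element of `A`. -/
def StdMon.elt {ψ : PathAlgebra K V →ₐ[K] A} (b : StdMon lt ψ) : A :=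
  ψ (PathAlgebra.mon K b.lift)

variable (lt)

/-- `x` is the expression of `a ∈ A` as a linear combination of standard monomials. -/
def IsStdExpr (x : PathAlgebra K V) (a : A) : Prop :=
  ψ x = a ∧ ∀ b, x.coeff b ≠ 0 → IsStandard lt ψ b

/-- `b` is the leading monomial of `a ∈ A`. -/
def IsLMAlg (a : A) (b : StdMon lt ψ) : Prop :=
  ∃ x, IsStdExpr lt ψ x a ∧ IsLeading lt x.coeff b.lift

variable {lt ψ}

/-- `c` is the cofactor of a toppling of `b`. -/
def IsTopplingCofactor (b c : StdMon lt ψ) : Prop :=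
  (∃ t, IsLMAlg lt ψ (b.elt * c.elt) t ∧ ¬ PathMon.Divides b.lift t.lift) ∨ b.elt * c.elt = 0

/-- `c` is a small cofactor of `b`. -/
def IsSmallCofactor (b c : StdMon lt ψ) : Prop := ¬ IsTopplingCofactor b c

/-- A monomial ordering on the free right module `F = A ^ r`, compatible with the ordering on
`A`; `(i, b)` stands for the monomial `𝔳ᵢ b`. In `mul` the path `u` is standard, that is,
`𝔳ᵢ b₁ b = 𝔳ᵢ u` is itself a monomial of `F`; then `b` is a small cofactor of `b₁`. -/
structure IsCompatibleOrder {r : ℕ} (ltF : Fin r × StdMon lt ψ → Fin r × StdMon lt ψ → Prop) :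
    Prop where
  total : IsStrictTotalOrder (Fin r × StdMon lt ψ) ltF
  compat : ∀ i (b₁ b₂ : StdMon lt ψ), lt b₂.lift b₁.lift → ltF (i, b₂) (i, b₁)
  mul : ∀ i j (b₁ b₂ b u w : StdMon lt ψ), ltF (j, b₂) (i, b₁) →
    PathMon.comp b₁.lift b.lift = some u.lift → IsLMAlg lt ψ (b₂.elt * b.elt) w →
    ltF (j, w) (i, u)

/-- `s` is the leading monomial of `f ∈ A ^ r`. -/
def IsLM {r : ℕ} (ltF : Fin r × StdMon lt ψ → Fin r × StdMon lt ψ → Prop) (f : Fin r → A)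
    (s : Fin r × StdMon lt ψ) : Prop :=
  ∃ x : Fin r → PathAlgebra K V, (∀ i, IsStdExpr lt ψ (x i) (f i)) ∧
    IsLeading ltF (fun t => (x t.1).coeff t.2.lift) s

end Quotient

/-! ### Signatures

`E` is the free right module of rank `m` over the path algebra, realised as
`Fin m → PathAlgebra K V`; the pair `(i, p)` stands for the monomial `𝔢ᵢ p` of `E`. -/

/-- A monomial ordering on `E`, compatible with the ordering `lt` on the path algebra. -/
structure IsCompatibleFreeOrder {V : Type*} [Quiver V] {m : ℕ}
    (lt : PathMon V → PathMon V → Prop)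
    (ltE : Fin m × PathMon V → Fin m × PathMon V → Prop) : Prop where
  total : IsStrictTotalOrder (Fin m × PathMon V) ltE
  compat : ∀ i b₁ b₂, lt b₂ b₁ → ltE (i, b₂) (i, b₁)
  mul : ∀ i j b₁ b₂ b u w, ltE (j, b₂) (i, b₁) →
    PathMon.comp b₁ b = some u → PathMon.comp b₂ b = some w → ltE (j, w) (i, u)

/-- A negative degree ordering on `E`: monomials of greater degree are smaller. -/
def IsNegativeDegreeOrder {V : Type*} [Quiver V] {m : ℕ}
    (ltE : Fin m × PathMon V → Fin m × PathMon V → Prop) : Prop :=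
  ∀ s t, t.2.deg < s.2.deg → ltE s t

/-- The evaluation map `E → F`, `𝔢ᵢ p ↦ gᵢ ψ(p)`, for the generators `gᵢ = gen i`. -/
def ev (ψ : PathAlgebra K V →ₐ[K] A) {r m : ℕ} (gen : Fin m → Fin r → A)
    (x : Fin m → PathAlgebra K V) : Fin r → A :=
  ∑ i, MulOpposite.op (ψ (x i)) • gen i

/-- The set of all signed elements `(f, s)` with `f ≠ 0` of the module generated by `gen`. -/
def signedElements (ψ : PathAlgebra K V →ₐ[K] A) {r m : ℕ} (gen : Fin m → Fin r → A)
    (ltE : Fin m × PathMon V → Fin m × PathMon V → Prop) :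
    Set ((Fin r → A) × (Fin m × PathMon V)) :=
  {g | g.1 ≠ 0 ∧ ∃ x : Fin m → PathAlgebra K V,
    IsLeading ltE (fun t => (x t.1).coeff t.2) g.2 ∧ ev ψ gen x = g.1}

section Reduction

variable {lt : PathMon V → PathMon V → Prop} {ψ : PathAlgebra K V →ₐ[K] A} {r m : ℕ}

/-- There are `g ∈ G` and a small cofactor `c` of `LM(g)` such that `LM(g) c = LM(f)`, the product
`σ(g) λ(c)` is nonzero (hence a monomial of `E`), and it is related to `s` by `R`. -/
def ReducibleBy (ltF : Fin r × StdMon lt ψ → Fin r × StdMon lt ψ → Prop)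
    (R : Fin m × PathMon V → Fin m × PathMon V → Prop)
    (G : Set ((Fin r → A) × (Fin m × PathMon V))) (f : Fin r → A) (s : Fin m × PathMon V) :
    Prop :=
  ∃ g ∈ G, ∃ (i : Fin r) (b c t : StdMon lt ψ) (u : PathMon V),
    IsLM ltF g.1 (i, b) ∧ IsSmallCofactor b c ∧ IsLM ltF f (i, t) ∧ b.elt * c.elt = t.elt ∧
      PathMon.comp g.2.2 c.lift = some u ∧ R (g.2.1, u) s

/-- `f` is `s`-reducible with respect to `G`. -/
def SReducible (ltF : Fin r × StdMon lt ψ → Fin r × StdMon lt ψ → Prop)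
    (ltE : Fin m × PathMon V → Fin m × PathMon V → Prop)
    (G : Set ((Fin r → A) × (Fin m × PathMon V))) (f : Fin r → A) (s : Fin m × PathMon V) :
    Prop :=
  ReducibleBy ltF ltE G f s

/-- `f` is weakly `s`-reducible with respect to `G`. -/
def WeaklySReducible (ltF : Fin r × StdMon lt ψ → Fin r × StdMon lt ψ → Prop)
    (ltE : Fin m × PathMon V → Fin m × PathMon V → Prop)
    (G : Set ((Fin r → A) × (Fin m × PathMon V))) (f : Fin r → A) (s : Fin m × PathMon V) :
    Prop :=
  ReducibleBy ltF (fun a b => a = b ∨ ltE a b) G f s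

/-- `G` is interreduced: every `g ∈ G` is irreducible with respect to `G`, and there are no other
`g' ∈ G` and small cofactor `c` of `LM(g')` with `LM(g') c = LM(g)` and `σ(g') λ(c) = σ(g)`. -/
def IsInterreduced (ltF : Fin r × StdMon lt ψ → Fin r × StdMon lt ψ → Prop)
    (ltE : Fin m × PathMon V → Fin m × PathMon V → Prop)
    (G : Set ((Fin r → A) × (Fin m × PathMon V))) : Prop :=
  ∀ g ∈ G, ¬ SReducible ltF ltE G g.1 g.2 ∧ ¬ ReducibleBy ltF Eq (G \ {g}) g.1 g.2

/-- `G` is a signed standard basis of the module generated by `gen`. -/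
structure IsSignedStandardBasis (gen : Fin m → Fin r → A)
    (ltF : Fin r × StdMon lt ψ → Fin r × StdMon lt ψ → Prop)
    (ltE : Fin m × PathMon V → Fin m × PathMon V → Prop)
    (G : Set ((Fin r → A) × (Fin m × PathMon V))) : Prop where
  finite : G.Finite
  signed : G ⊆ signedElements ψ gen ltE
  reduces : ∀ f ∈ signedElements ψ gen ltE,
    ¬ SReducible ltF ltE (signedElements ψ gen ltE) f.1 f.2 → WeaklySReducible ltF ltE G f.1 f.2

/-- The elements of the signed set `G` whose signature has degree zero. -/
def degreeZero (G : Set ((Fin r → A) × (Fin m × PathMon V))) :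
    Set ((Fin r → A) × (Fin m × PathMon V)) :=
  {g | g ∈ G ∧ g.2.2.deg = 0}

end Reduction

/-- `f ∈ A ^ r` is uniform: `f 1ᵥ = f` for some vertex `v`. -/
def IsUniform (ψ : PathAlgebra K V →ₐ[K] A) {r : ℕ} (f : Fin r → A) : Prop :=
  ∃ v : V, MulOpposite.op (ψ (PathAlgebra.mon K (PathMon.triv v))) • f = f

end SignedStd

end

/-!
Order the monomials of `E` by `ltE` and filter `M` by the subspaces `M_{≤ s}` and `M_{< s}` spanned
by the images of the monomials `t ≤ s`, respectively `t < s` (`evSpan` of `upTo` and of `below`).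
Each step `M_{≤ s} / M_{< s}` is at most one-dimensional. A signed element `(f, s)` is reducible
with respect to all signed elements only if `LM(f)` is the leading monomial of an element of
`M_{< s}`. The point is that a reduction by `g` and a small cofactor `c` may be replaced by one with
the cofactor `d ≤ c` for which the lift of `LM(f)` is the concatenation of the lifts of `LM(g)` and
`d` (`exists_cofactor_le`), and that leading monomials are multiplicative for such `d` (`IsLM.act`).

Reducing an element of `M_{≤ s}` modulo `M_{< s}` shows that each nonzero step of the filtration is
`M_{≤ σ(g) c} / M_{< σ(g) c}` for some `g ∈ G` and some path `c`
(`IsSignedStandardBasis.exists_signature`). If `s` has degree zero, then `c` is trivial and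
`σ(g) = s`. Conversely, if `G` is interreduced, then the leading monomial of `g ∈ G` is not one of
`M_{< σ(g)}` (`IsSignedStandardBasis.not_isLM_below`), so `g` spans the step at `σ(g)`, and distinct
elements of `G` have distinct signatures (`IsSignedStandardBasis.signature_injOn`). The latter uses
that `LM(g)` and `σ(g)` end at the same vertex (`IsSignedStandardBasis.tgt_eq`).

Let `J` be the ideal of `A` generated by the arrows. As `E` carries a negative degree ordering,
`M J`, the image of the monomials of positive degree (`degSpan` for `n = 1`), lies below all steps
of degree zero. Hence the elements of `G` with signature of degree zero form a basis of `M / M J`.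
Nakayama's lemma for the nilpotent ideal `J` (`degSpan_zero_le`) turns this into a generating set of
`M`, and `M J` is the radical of `M`: it is contained in it by Nakayama's lemma again, and contains
it because `M / M J` embeds into a product of modules of `K`-dimension one. For uniform elements,
the submodule generated by a subset is its `K`-span modulo `M J`, so none of them can be omitted.
-/

noncomputable section

namespace SignedStd

/-! ### Paths and elements of the path algebra -/

namespace PathMon

variable {V : Type*} [Quiver V]

theorem comp_eq_some {p q u : PathMon V} (h : comp p q = some u) :
    p.tgt = q.src ∧ u.src = p.src ∧ u.tgt = q.tgt ∧ u.deg = p.deg + q.deg := by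
  obtain ⟨a, b, p⟩ := p
  obtain ⟨c, d, q⟩ := q
  by_cases hbc : b = c
  · subst hbc
    simp only [comp, dif_pos, Option.some.injEq] at h
    subst h
    simp [deg]
  · simp [comp, hbc] at h

theorem exists_comp {p q : PathMon V} (h : p.tgt = q.src) : ∃ u, comp p q = some u := by
  simp [comp, h]

theorem comp_eq_none {p q : PathMon V} (h : p.tgt ≠ q.src) : comp p q = none := by
  simp [comp, h]

theorem comp_triv_self (p : PathMon V) : comp p (triv p.tgt) = some p := by
  classical simp [comp_triv]

theorem triv_comp_self (p : PathMon V) : comp (triv p.src) p = some p := by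
  classical simp [triv_comp]

theorem comp_left_cancel {p q q' u : PathMon V} (h : comp p q = some u)
    (h' : comp p q' = some u) : q = q' := by
  obtain ⟨a, b, p⟩ := p
  obtain ⟨c, d, q⟩ := q
  obtain ⟨c', d', q'⟩ := q'
  obtain rfl : b = c := (comp_eq_some h).1
  obtain rfl : b = c' := (comp_eq_some h').1
  simp only [comp, dif_pos, Option.some.injEq] at h h'
  subst h
  simp only [PathMon.mk.injEq, true_and] at h'
  obtain ⟨rfl, h'⟩ := h'
  have := eq_of_heq h'
  simp only [Quiver.Path.cast_rfl_rfl] at this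
  rw [Quiver.Path.comp_inj_right.1 this]

theorem eq_triv_of_deg_eq_zero {p : PathMon V} (h : p.deg = 0) : p = triv p.tgt := by
  obtain ⟨a, b, p⟩ := p
  cases p with
  | nil => rfl
  | cons p e => simp [deg] at h

variable [Fintype V] [∀ a b : V, Finite (a ⟶ b)]

theorem finite_deg_eq (n : ℕ) : {p : PathMon V | p.deg = n}.Finite := by
  induction n with
  | zero =>
    refine (Set.finite_range (triv (V := V))).subset fun p hp => ?_
    exact ⟨p.tgt, (eq_triv_of_deg_eq_zero hp).symm⟩
  | succ n ih =>
    have := ih.to_subtype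
    let f : (Σ p : {p : PathMon V | p.deg = n}, Σ w : V, (p.1.tgt ⟶ w)) → PathMon V :=
      fun x => ⟨x.1.1.src, x.2.1, x.1.1.path.cons x.2.2⟩
    refine (Set.finite_range f).subset fun p hp => ?_
    obtain ⟨a, b, p⟩ := p
    cases p with
    | nil => simp [deg] at hp
    | cons p e =>
      refine ⟨⟨⟨⟨a, _, p⟩, ?_⟩, ⟨_, e⟩⟩, rfl⟩
      simpa [deg] using hp

/-- A finite quiver has finitely many paths of bounded length. -/
theorem finite_deg_lt (n : ℕ) : {p : PathMon V | p.deg < n}.Finite := by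
  have h : {p : PathMon V | p.deg < n} = ⋃ k ∈ Set.Iio n, {p : PathMon V | p.deg = k} := by
    ext p
    simp
  rw [h]
  exact (Set.finite_Iio n).biUnion fun k _ => finite_deg_eq k

end PathMon

namespace PathAlgebra

variable {K V : Type*} [Field K] [Quiver V]

/-- The coefficient of a path, as a linear form. -/
def coeffHom (p : PathMon V) : PathAlgebra K V →ₗ[K] K :=
  (Finsupp.lapply p : (PathMon V →₀ K) →ₗ[K] K)

theorem coeffHom_apply (p : PathMon V) (x : PathAlgebra K V) : coeffHom p x = x.coeff p := rfl

@[simp] theorem coeff_add (x y : PathAlgebra K V) (p) : (x + y).coeff p = x.coeff p + y.coeff p :=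
  map_add (coeffHom p) x y

@[simp] theorem coeff_sub (x y : PathAlgebra K V) (p) : (x - y).coeff p = x.coeff p - y.coeff p :=
  map_sub (coeffHom p) x y

@[simp] theorem coeff_smul (a : K) (x : PathAlgebra K V) (p) : (a • x).coeff p = a * x.coeff p :=
  map_smul (coeffHom p) a x

@[simp] theorem coeff_zero (p : PathMon V) : (0 : PathAlgebra K V).coeff p = 0 := rfl

open Classical in
theorem coeff_mon (q p : PathMon V) : (mon K q).coeff p = if q = p then 1 else 0 :=
  Finsupp.single_apply

@[simp] theorem coeff_mon_self (p : PathMon V) : (mon K p).coeff p = 1 := by simp [coeff_mon]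

theorem eq_of_coeff_mon_ne_zero {q p : PathMon V} (h : (mon K q).coeff p ≠ 0) : p = q := by
  by_contra hne
  exact h (by simp [coeff_mon, Ne.symm hne])

@[ext] theorem ext {x y : PathAlgebra K V} (h : ∀ p, x.coeff p = y.coeff p) : x = y :=
  Finsupp.ext h

theorem finite_support (x : PathAlgebra K V) : {p | x.coeff p ≠ 0}.Finite :=
  Finsupp.hasFiniteSupport (show PathMon V →₀ K from x)

/-- A linear map sends `x` into every subspace that contains the images of the monomials occurring
in `x`. -/
theorem map_mem {N : Type*} [AddCommGroup N] [Module K N] (L : PathAlgebra K V →ₗ[K] N)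
    (W : Submodule K N) (x : PathAlgebra K V) (h : ∀ p, x.coeff p ≠ 0 → L (mon K p) ∈ W) :
    L x ∈ W := by
  have hx : x = Finsupp.sum (show PathMon V →₀ K from x)
      (fun p a => (a • mon K p : PathAlgebra K V)) := by
    conv_lhs => rw [← Finsupp.sum_single (show PathMon V →₀ K from x)]
    refine Finsupp.sum_congr fun p _ => ?_
    exact (Finsupp.smul_single_one p _).symm
  rw [hx, Finsupp.sum, map_sum]
  refine W.sum_mem fun p hp => ?_
  rw [map_smul]
  exact W.smul_mem _ (h p (Finsupp.mem_support_iff.1 hp))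

theorem mon_mul_of_comp {p q u : PathMon V} (h : PathMon.comp p q = some u) :
    mon K p * mon K q = mon K u := by
  rw [mon_mul_mon, monMul, h]; rfl

theorem mon_mul_of_ne {p q : PathMon V} (h : p.tgt ≠ q.src) : mon K p * mon K q = 0 := by
  rw [mon_mul_mon, monMul, PathMon.comp_eq_none h]; rfl

variable [Fintype V]

theorem sum_mon_triv : ∑ v, mon K (PathMon.triv v) = (1 : PathAlgebra K V) := rfl

theorem exists_of_coeff_mon_mul_ne_zero {b p : PathMon V} {x : PathAlgebra K V}
    (h : (mon K b * x).coeff p ≠ 0) : ∃ q, x.coeff q ≠ 0 ∧ PathMon.comp b q = some p := by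
  by_contra hc
  push Not at hc
  refine h ?_
  have := map_mem ((coeffHom p).comp (LinearMap.mulLeft K (mon K b))) ⊥ x fun q hq => ?_
  · exact (Submodule.mem_bot K).1 this
  · change coeffHom p (mon K b * mon K q) ∈ (⊥ : Submodule K K)
    by_cases hb : b.tgt = q.src
    · obtain ⟨u, hu⟩ := PathMon.exists_comp hb
      rw [mon_mul_of_comp hu, coeffHom_apply, Submodule.mem_bot]
      by_contra hne
      exact hc q hq (by rw [eq_of_coeff_mon_ne_zero hne, hu])
    · rw [mon_mul_of_ne hb, map_zero]; exact zero_mem _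

theorem coeff_mon_mul_of_comp {b q p : PathMon V} (h : PathMon.comp b q = some p)
    (x : PathAlgebra K V) : (mon K b * x).coeff p = x.coeff q := by
  have : (coeffHom p).comp (LinearMap.mulLeft K (mon K b)) = coeffHom (K := K) q := by
    refine hom_ext fun q' => ?_
    change (mon K b * mon K q').coeff p = (mon K q').coeff q
    by_cases hq : q' = q
    · subst hq
      rw [mon_mul_of_comp h]; simp
    · rw [coeff_mon, if_neg hq]
      by_contra hne
      obtain ⟨q'', h1, h2⟩ := exists_of_coeff_mon_mul_ne_zero hne
      rw [eq_of_coeff_mon_ne_zero h1] at h2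
      exact hq (PathMon.comp_left_cancel h2 h)
  exact LinearMap.congr_fun this x

/-- Multiplication by trivial paths on both sides selects the paths with given endpoints. -/
theorem coeff_triv_mul_mul_triv (v w : V) (x : PathAlgebra K V) (p : PathMon V)
    [Decidable (p.src = v ∧ p.tgt = w)] :
    (mon K (PathMon.triv v) * x * mon K (PathMon.triv w)).coeff p =
      if p.src = v ∧ p.tgt = w then x.coeff p else 0 := by
  have : (coeffHom p).comp ((LinearMap.mulRight K (mon K (PathMon.triv w))).comp
      (LinearMap.mulLeft K (mon K (PathMon.triv v)))) =
      if p.src = v ∧ p.tgt = w then coeffHom (K := K) p else 0 := by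
    refine hom_ext fun q => ?_
    change (mon K (PathMon.triv v) * mon K q * mon K (PathMon.triv w)).coeff p = _
    by_cases h1 : v = q.src
    · subst h1
      rw [mon_mul_of_comp (PathMon.triv_comp_self q)]
      by_cases h2 : q.tgt = w
      · subst h2
        rw [mon_mul_of_comp (PathMon.comp_triv_self q)]
        by_cases h3 : q = p
        · subst h3; simp [coeffHom_apply]
        · split_ifs
          · rfl
          · simp [coeff_mon, h3]
      · rw [mon_mul_of_ne (by exact h2)]
        split_ifs with h
        · by_cases h3 : q = p
          · subst h3; exact absurd h.2 h2
          · simp [coeff_mon, h3, coeffHom_apply]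
        · simp
    · rw [mon_mul_of_ne (by exact h1), zero_mul]
      split_ifs with h
      · by_cases h3 : q = p
        · subst h3; exact absurd h.1.symm h1
        · simp [coeff_mon, h3, coeffHom_apply]
      · simp
  have := LinearMap.congr_fun this x
  split_ifs at this ⊢ <;> exact this

end PathAlgebra

/-! ### Leading indices -/

theorem IsLeading.unique {ι K : Type*} [Zero K] {lt : ι → ι → Prop} [IsStrictTotalOrder ι lt]
    {c : ι → K} {s t : ι} (hs : IsLeading lt c s) (ht : IsLeading lt c t) : s = t := by
  rcases hs.2 t ht.1 with h | h
  · exact h.symm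
  · rcases ht.2 s hs.1 with h' | h'
    · exact h'
    · exact absurd (_root_.trans h h') (irrefl t)

/-- In a finite nonempty set, a strict total order has a least element. -/
theorem exists_least {ι : Type*} (lt : ι → ι → Prop) [IsStrictTotalOrder ι lt] {S : Set ι}
    (hS : S.Finite) (hne : S.Nonempty) : ∃ s ∈ S, ∀ t ∈ S, t = s ∨ lt s t := by
  classical
  let _ := linearOrderOfSTO lt
  obtain ⟨s, hs, h⟩ := hS.toFinset.exists_min_image id (by simpa using hne)
  refine ⟨s, by simpa using hs, fun t ht => ?_⟩
  rcases (h t (by simpa using ht)).lt_or_eq with h | h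
  · exact Or.inr h
  · exact Or.inl h.symm

theorem exists_isLeading {ι K : Type*} [Zero K] (lt : ι → ι → Prop) [IsStrictTotalOrder ι lt]
    {c : ι → K} (hc : {i | c i ≠ 0}.Finite) (hne : ∃ i, c i ≠ 0) : ∃ s, IsLeading lt c s := by
  obtain ⟨s, hs, h⟩ := exists_least (Function.swap lt) hc hne
  exact ⟨s, hs, h⟩

open PathAlgebra

/-! ### Standard monomials -/

section Standard

variable {K V A : Type*} [Field K] [Quiver V] [Fintype V] [Ring A] [Algebra K A]
  {lt : PathMon V → PathMon V → Prop} {ψ : PathAlgebra K V →ₐ[K] A}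

theorem IsStandard.deg_lt {N : ℕ} (hN : ∀ p : PathMon V, N ≤ p.deg → ψ (mon K p) = 0)
    {b : PathMon V} (hb : IsStandard lt ψ b) : b.deg < N := by
  by_contra h
  refine hb (mon K b) (hN b (not_lt.1 h)) ⟨by simp, fun t ht => ?_⟩
  exact Or.inl (eq_of_coeff_mon_ne_zero ht)

theorem IsBasicPresentation.finite_stdMon [∀ a b : V, Finite (a ⟶ b)]
    (hψ : IsBasicPresentation ψ) : Finite (StdMon lt ψ) := by
  obtain ⟨N, hN⟩ := hψ.long_paths
  exact Set.Finite.to_subtype ((PathMon.finite_deg_lt N).subset fun _ hb => IsStandard.deg_lt hN hb)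

variable (lt ψ) in
/-- The span of the standard monomials in the path algebra. -/
def stdSpan : Submodule K (PathAlgebra K V) where
  carrier := {x | ∀ b, x.coeff b ≠ 0 → IsStandard lt ψ b}
  zero_mem' b hb := absurd rfl hb
  add_mem' {x y} hx hy b hb := by
    by_cases h : x.coeff b = 0
    · exact hy b (by simpa [h] using hb)
    · exact hx b h
  smul_mem' a x hx b hb := hx b (right_ne_zero_of_mul (by simpa using hb))

theorem mon_mem_stdSpan {b : PathMon V} (hb : IsStandard lt ψ b) : mon K b ∈ stdSpan lt ψ := by
  intro p hp
  rwa [eq_of_coeff_mon_ne_zero hp]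

theorem mem_map_stdSpan [∀ a b : V, Finite (a ⟶ b)] (hψ : IsBasicPresentation ψ)
    (hlt : IsMonomialOrder lt) (p : PathMon V) :
    ψ (mon K p) ∈ (stdSpan lt ψ).map ψ.toLinearMap := by
  have := hlt.total
  obtain ⟨N, hN⟩ := hψ.long_paths
  by_contra hp
  -- A least counterexample is the leading monomial of a relation, which expresses it by smaller
  -- monomials.
  obtain ⟨q, hq, hmin⟩ := exists_least lt
    (S := {q | q.deg < N ∧ ψ (mon K q) ∉ (stdSpan lt ψ).map ψ.toLinearMap})
    ((PathMon.finite_deg_lt N).subset fun q hq => hq.1)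
    ⟨p, by by_contra h; exact hp (by rw [hN p (not_lt.1 h)]; exact zero_mem _), hp⟩
  have hns : ¬ IsStandard lt ψ q := fun h => hq.2 ⟨_, mon_mem_stdSpan h, rfl⟩
  simp only [IsStandard, not_forall, not_not] at hns
  obtain ⟨x, hx, hlead⟩ := hns
  have key : ψ.toLinearMap (x - x.coeff q • mon K q) ∈ (stdSpan lt ψ).map ψ.toLinearMap := by
    refine map_mem _ _ _ fun t ht => ?_
    have htq : t ≠ q := by
      rintro rfl
      simp at ht
    have hxt : x.coeff t ≠ 0 := by
      intro h0
      refine ht ?_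
      rw [coeff_sub, coeff_smul, h0, coeff_mon, if_neg htq.symm]
      simp
    have hlt' := (hlead.2 t hxt).resolve_left htq
    by_contra hbad
    have htN : t.deg < N := by
      by_contra h
      exact hbad (by rw [AlgHom.toLinearMap_apply, hN t (not_lt.1 h)]; exact zero_mem _)
    rcases hmin t ⟨htN, hbad⟩ with h | h
    · exact htq h
    · exact irrefl t (_root_.trans hlt' h)
  rw [map_sub, map_smul, AlgHom.toLinearMap_apply, hx, zero_sub, Submodule.neg_mem_iff] at key
  exact hq.2 (by simpa [hlead.1] using Submodule.smul_mem _ (x.coeff q)⁻¹ key)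

variable [∀ a b : V, Finite (a ⟶ b)]

/-- The standard monomials are mapped to a basis of `A`. -/
def stdEquiv (hψ : IsBasicPresentation ψ) (hlt : IsMonomialOrder lt) : stdSpan lt ψ ≃ₗ[K] A :=
  LinearEquiv.ofBijective (ψ.toLinearMap.domRestrict (stdSpan lt ψ)) <| by
    have := hlt.total
    refine ⟨(injective_iff_map_eq_zero _).2 fun x hx => ?_, fun a => ?_⟩
    · by_contra hne
      obtain ⟨s, hs⟩ := exists_isLeading lt (c := x.1.coeff) x.1.finite_support (by
        by_contra h
        push Not at h
        exact hne (Subtype.ext (PathAlgebra.ext h)))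
      exact x.2 s hs.1 x.1 hx hs
    · obtain ⟨y, rfl⟩ := hψ.surjective a
      obtain ⟨x, hx, h⟩ :=
        map_mem ψ.toLinearMap ((stdSpan lt ψ).map ψ.toLinearMap) y
          fun p _ => mem_map_stdSpan hψ hlt p
      exact ⟨⟨x, hx⟩, h⟩

/-- The expression of an element of `A` in standard monomials. -/
def normalForm (hψ : IsBasicPresentation ψ) (hlt : IsMonomialOrder lt) : A →ₗ[K] PathAlgebra K V :=
  (stdSpan lt ψ).subtype.comp (stdEquiv hψ hlt).symm.toLinearMap

variable (hψ : IsBasicPresentation ψ) (hlt : IsMonomialOrder lt)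

include hψ hlt

theorem isStdExpr_iff {x : PathAlgebra K V} {a : A} :
    IsStdExpr lt ψ x a ↔ x = normalForm hψ hlt a := by
  constructor
  · rintro ⟨rfl, hx⟩
    have : stdEquiv hψ hlt ⟨x, hx⟩ = ψ x := rfl
    rw [normalForm, ← this]
    simp
  · rintro rfl
    exact ⟨(stdEquiv hψ hlt).apply_symm_apply a, ((stdEquiv hψ hlt).symm a).2⟩

theorem map_normalForm (a : A) : ψ (normalForm hψ hlt a) = a :=
  ((isStdExpr_iff hψ hlt).2 rfl).1

theorem normalForm_elt (b : StdMon lt ψ) : normalForm hψ hlt b.elt = mon K b.lift :=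
  ((isStdExpr_iff hψ hlt).1 ⟨rfl, mon_mem_stdSpan b.2⟩).symm

theorem isLMAlg_iff {a : A} {b : StdMon lt ψ} :
    IsLMAlg lt ψ a b ↔ IsLeading lt (normalForm hψ hlt a).coeff b.lift := by
  constructor
  · rintro ⟨x, hx, h⟩
    rwa [(isStdExpr_iff hψ hlt).1 hx] at h
  · exact fun h => ⟨_, (isStdExpr_iff hψ hlt).2 rfl, h⟩

theorem exists_isLMAlg {a : A} (ha : a ≠ 0) : ∃ b, IsLMAlg lt ψ a b := by
  have := hlt.total
  obtain ⟨s, hs⟩ := exists_isLeading lt (normalForm hψ hlt a).finite_support (by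
    by_contra h
    push Not at h
    apply ha
    rw [← map_normalForm hψ hlt a, PathAlgebra.ext (y := 0) h, map_zero])
  exact ⟨⟨s, ((isStdExpr_iff hψ hlt).2 rfl).2 s hs.1⟩, (isLMAlg_iff hψ hlt).2 hs⟩

theorem StdMon.elt_ne_zero (b : StdMon lt ψ) : b.elt ≠ 0 := by
  intro h
  have := normalForm_elt hψ hlt b
  rw [h, map_zero] at this
  simpa using congrArg (fun x => x.coeff b.lift) this

omit hψ [∀ a b : V, Finite (a ⟶ b)] in
/-- A terminal segment of a standard monomial is standard. -/
theorem IsStandard.of_comp {b d t : PathMon V} (ht : IsStandard lt ψ t)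
    (h : PathMon.comp b d = some t) : IsStandard lt ψ d := by
  classical
  intro x hx hlead
  -- The terms of `x` parallel to `d` form a relation; multiply it by `b` from the left.
  set y := mon K (PathMon.triv d.src) * x * mon K (PathMon.triv d.tgt) with hy
  have hyc := coeff_triv_mul_mul_triv d.src d.tgt x
  refine ht (mon K b * y) (by simp [hy, hx]) ⟨?_, fun p hp => ?_⟩
  · rw [coeff_mon_mul_of_comp h, hy, hyc]
    simpa using hlead.1
  · obtain ⟨q, hq, hbq⟩ := exists_of_coeff_mon_mul_ne_zero hp
    rw [hy, hyc] at hq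
    simp only [ne_eq, ite_eq_right_iff, not_forall] at hq
    obtain ⟨⟨h1, h2⟩, hq⟩ := hq
    rcases hlead.2 q hq with rfl | hqd
    · exact Or.inl (Option.some_injective _ (hbq.symm.trans h))
    · refine Or.inr (hlt.mul d q (PathMon.triv d.tgt) b d q t p hqd ?_ ?_ h hbq).2
      · exact PathMon.comp_triv_self d
      · rw [← h2]; exact PathMon.comp_triv_self q

omit hψ [∀ a b : V, Finite (a ⟶ b)] in
/-- If a monomial is the product of `b` and `c`, and its lift starts with the lift of `b`, then the
remaining factor `d` is a monomial not greater than `c`. -/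
theorem exists_cofactor_le (hn : ∀ b : StdMon lt ψ, b.elt ≠ 0) {b c t : StdMon lt ψ}
    (h : b.elt * c.elt = t.elt) (hd : PathMon.Divides b.lift t.lift) :
    ∃ d : StdMon lt ψ, PathMon.comp b.lift d.lift = some t.lift ∧ d.lift.src = c.lift.src ∧
      d.lift.tgt = c.lift.tgt ∧ (d = c ∨ lt d.lift c.lift) := by
  have := hlt.total
  obtain ⟨d, hd⟩ := hd
  have hds := IsStandard.of_comp hlt t.2 hd
  have h0 : b.elt * c.elt ≠ 0 := h ▸ hn t
  have hsrc : b.lift.tgt = c.lift.src := by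
    by_contra hne
    refine h0 ?_
    rw [StdMon.elt, StdMon.elt, ← map_mul, mon_mul_of_ne hne, map_zero]
  have htgt : c.lift.tgt = t.lift.tgt := by
    by_contra hne
    have h1 : b.elt * c.elt * ψ (mon K (PathMon.triv t.lift.tgt)) = 0 := by
      rw [mul_assoc, StdMon.elt, StdMon.elt, ← map_mul (f := ψ) (mon K c.lift),
        mon_mul_of_ne (by exact hne), map_zero, mul_zero]
    rw [h, StdMon.elt, ← map_mul, mon_mul_of_comp (PathMon.comp_triv_self _)] at h1
    exact hn t h1
  have hd' := PathMon.comp_eq_some hd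
  refine ⟨⟨d, hds⟩, hd, hd'.1.symm.trans hsrc, hd'.2.2.1.symm.trans htgt.symm, ?_⟩
  obtain ⟨w, hw⟩ := PathMon.exists_comp hsrc
  have hw' := PathMon.comp_eq_some hw
  rcases trichotomous_of lt d c.lift with hlt' | heq | hgt
  · exact Or.inr hlt'
  · exact Or.inl (Subtype.ext heq)
  · -- Otherwise `t` would be the leading monomial of the relation `t - b c`.
    exfalso
    have htc : d.tgt = c.lift.tgt := hd'.2.2.1.symm.trans htgt.symm
    have hwt : lt w t.lift := (hlt.mul d c.lift (PathMon.triv d.tgt) b.lift d c.lift t.lift w hgt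
      (PathMon.comp_triv_self d) (by rw [htc]; exact PathMon.comp_triv_self _) hd hw).2
    have hne : t.lift ≠ w := fun he => irrefl w (he ▸ hwt)
    refine t.2 (mon K t.lift - mon K w) ?_ ⟨?_, fun p hp => ?_⟩
    · rw [map_sub, ← mon_mul_of_comp hw, map_mul]
      exact sub_eq_zero.2 h.symm
    · change (mon K t.lift - mon K w).coeff t.lift ≠ 0
      rw [coeff_sub, coeff_mon_self, coeff_mon, if_neg hne.symm]
      simp
    · by_cases hpt : (mon K t.lift).coeff p = 0
      · rw [coeff_sub, hpt, zero_sub, neg_ne_zero] at hp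
        rw [eq_of_coeff_mon_ne_zero hp]
        exact Or.inr hwt
      · exact Or.inl (eq_of_coeff_mon_ne_zero hpt)

end Standard

/-! ### Right multiplication by paths and leading monomials in the free module -/

section Free

variable {K V A : Type*} [Field K] [Quiver V] [Fintype V] [Ring A] [Algebra K A]
  {lt : PathMon V → PathMon V → Prop} {ψ : PathAlgebra K V →ₐ[K] A} {r : ℕ}

variable (ψ r) in
/-- Right multiplication of `A ^ r` by an element of the path algebra, linear in both arguments. -/
def actHom : PathAlgebra K V →ₗ[K] (Fin r → A) →ₗ[K] (Fin r → A) :=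
  LinearMap.mk₂ K (fun x f i => f i * ψ x) (fun x y f => by ext i; simp [mul_add])
    (fun c x f => by ext i; simp) (fun x f g => by ext i; simp [add_mul])
    (fun c x f => by ext i; simp)

theorem actHom_apply (x : PathAlgebra K V) (f : Fin r → A) :
    actHom ψ r x f = MulOpposite.op (ψ x) • f := rfl

variable (ψ) in
/-- Right multiplication of `A ^ r` by a path. -/
def act (p : PathMon V) : (Fin r → A) →ₗ[K] (Fin r → A) := actHom ψ r (mon K p)

theorem act_apply (p : PathMon V) (f : Fin r → A) (i : Fin r) :
    act ψ p f i = f i * ψ (mon K p) := rfl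

theorem act_eq_smul (p : PathMon V) (f : Fin r → A) :
    act ψ p f = MulOpposite.op (ψ (mon K p)) • f := rfl

theorem act_act_of_comp {p q u : PathMon V} (h : PathMon.comp p q = some u) (f : Fin r → A) :
    act ψ q (act ψ p f) = act ψ u f := by
  ext i
  rw [act_apply, act_apply, act_apply, mul_assoc, ← map_mul, mon_mul_of_comp h]

theorem act_act_of_ne {p q : PathMon V} (h : p.tgt ≠ q.src) (f : Fin r → A) :
    act ψ q (act ψ p f) = 0 := by
  ext i
  rw [act_apply, act_apply, mul_assoc, ← map_mul, mon_mul_of_ne h, map_zero, mul_zero]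
  rfl

theorem sum_act_triv (f : Fin r → A) : ∑ v, act ψ (PathMon.triv v) f = f := by
  have : ∑ v, act ψ (PathMon.triv v) f = actHom ψ r (∑ v, mon K (PathMon.triv v)) f := by
    rw [map_sum, LinearMap.sum_apply]
    rfl
  rw [this, sum_mon_triv, actHom_apply, map_one, MulOpposite.op_one, one_smul]

/-- A subspace stable under right multiplication by paths is stable under `A`. -/
theorem op_smul_mem (hsurj : Function.Surjective ψ) {W : Submodule K (Fin r → A)} {f : Fin r → A}
    (h : ∀ p, act ψ p f ∈ W) (a : Aᵐᵒᵖ) : a • f ∈ W := by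
  obtain ⟨x, hx⟩ := hsurj a.unop
  have := map_mem ((actHom ψ r).flip f) W x fun p _ => h p
  rwa [LinearMap.flip_apply, actHom_apply, hx, MulOpposite.op_unop] at this

variable [∀ a b : V, Finite (a ⟶ b)]
  (hψ : IsBasicPresentation ψ) (hlt : IsMonomialOrder lt)

/-- The coefficients of an element of `A ^ r` at the monomials of `A ^ r`. -/
def coord (hψ : IsBasicPresentation ψ) (hlt : IsMonomialOrder lt) :
    (Fin r → A) →ₗ[K] (Fin r × StdMon lt ψ → K) :=
  LinearMap.pi fun t => (coeffHom t.2.lift).comp ((normalForm hψ hlt).comp (LinearMap.proj t.1))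

theorem coord_apply (f : Fin r → A) (t : Fin r × StdMon lt ψ) :
    coord hψ hlt f t = (normalForm hψ hlt (f t.1)).coeff t.2.lift := rfl

include hψ hlt

theorem isLM_iff {ltF : Fin r × StdMon lt ψ → Fin r × StdMon lt ψ → Prop} {f : Fin r → A}
    {s : Fin r × StdMon lt ψ} : IsLM ltF f s ↔ IsLeading ltF (coord hψ hlt f) s := by
  constructor
  · rintro ⟨x, hx, h⟩
    obtain rfl : x = fun i => normalForm hψ hlt (f i) :=
      funext fun i => (isStdExpr_iff hψ hlt).1 (hx i)
    exact h
  · exact fun h => ⟨_, fun i => (isStdExpr_iff hψ hlt).2 rfl, h⟩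

/-- A linear map sends `f` into every subspace that contains the images of the monomials of
`A ^ r` occurring in `f`. -/
theorem map_mem_of_coord {N : Type*} [AddCommGroup N] [Module K N] (L : (Fin r → A) →ₗ[K] N)
    (W : Submodule K N) (f : Fin r → A)
    (h : ∀ j (b : StdMon lt ψ), coord hψ hlt f (j, b) ≠ 0 → L (Pi.single j b.elt) ∈ W) :
    L f ∈ W := by
  have hf : L f = ∑ j, L (Pi.single j (f j)) := by
    rw [← map_sum, Finset.univ_sum_single]
  rw [hf]
  refine W.sum_mem fun j _ => ?_
  have := map_mem (L.comp ((LinearMap.single K (fun _ : Fin r => A) j).comp ψ.toLinearMap)) W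
    (normalForm hψ hlt (f j)) fun p hp => ?_
  · simpa [map_normalForm] using this
  · exact h j ⟨p, ((isStdExpr_iff hψ hlt).2 rfl).2 p hp⟩ hp

theorem coord_injective : Function.Injective (coord (r := r) hψ hlt) := by
  refine (injective_iff_map_eq_zero _).2 fun f hf => ?_
  have := map_mem_of_coord hψ hlt LinearMap.id ⊥ f fun j b hb => absurd (congrFun hf _) hb
  simpa using this

open Classical in
theorem coord_single (j : Fin r) (a : A) (t : Fin r × StdMon lt ψ) :
    coord hψ hlt (Pi.single j a) t =
      if t.1 = j then (normalForm hψ hlt a).coeff t.2.lift else 0 := by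
  rw [coord_apply]
  split_ifs with h
  · rw [h, Pi.single_eq_same]
  · rw [Pi.single_eq_of_ne h, map_zero, coeff_zero]

variable {ltF : Fin r × StdMon lt ψ → Fin r × StdMon lt ψ → Prop}

theorem exists_isLM (hltF : IsCompatibleOrder ltF) {f : Fin r → A} (hf : f ≠ 0) :
    ∃ s, IsLM ltF f s := by
  have := hltF.total
  have : Finite (StdMon lt ψ) := hψ.finite_stdMon
  simp only [isLM_iff hψ hlt]
  refine exists_isLeading ltF (Set.toFinite _) ?_
  by_contra h
  push Not at h
  exact hf (coord_injective hψ hlt ((funext h).trans (map_zero _).symm))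

theorem IsLM.unique (hltF : IsCompatibleOrder ltF) {f : Fin r → A} {s t : Fin r × StdMon lt ψ}
    (hs : IsLM ltF f s) (ht : IsLM ltF f t) : s = t := by
  have := hltF.total
  exact ((isLM_iff hψ hlt).1 hs).unique ((isLM_iff hψ hlt).1 ht)

theorem IsLM.ne_zero {f : Fin r → A} {s : Fin r × StdMon lt ψ} (hs : IsLM ltF f s) : f ≠ 0 := by
  rintro rfl
  exact ((isLM_iff hψ hlt).1 hs).1 (by rw [map_zero]; rfl)

/-- The leading monomial is multiplicative as long as the product of the lifts is standard. -/
theorem IsLM.act (hltF : IsCompatibleOrder ltF) {f : Fin r → A} {i : Fin r} {b d u : StdMon lt ψ}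
    (hf : IsLM ltF f (i, b)) (h : PathMon.comp b.lift d.lift = some u.lift) :
    IsLM ltF (act ψ d.lift f) (i, u) := by
  classical
  have := hltF.total
  have := hlt.total
  rw [isLM_iff hψ hlt] at hf
  -- The elements all of whose monomials are smaller than `(i, u)`.
  let W : Submodule K (Fin r → A) :=
    { carrier := {g | ∀ t, coord hψ hlt g t ≠ 0 → ltF t (i, u)}
      zero_mem' := fun t ht => absurd (by rw [map_zero]; rfl) ht
      add_mem' := fun {x y} hx hy t ht => by
        by_cases h0 : coord hψ hlt x t = 0
        · exact hy t (by simpa [h0] using ht)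
        · exact hx t h0
      smul_mem' := fun a x hx t ht => hx t (right_ne_zero_of_mul (by simpa using ht)) }
  have hact : ∀ j (b' : StdMon lt ψ), SignedStd.act ψ d.lift (Pi.single j b'.elt : Fin r → A) =
      Pi.single j (b'.elt * d.elt) := by
    intro j b'
    ext k
    rw [act_apply]
    by_cases hk : k = j
    · subst hk; simp [StdMon.elt]
    · simp [hk]
  set a := coord hψ hlt f (i, b) with ha
  have hsing : ∀ t, coord hψ hlt (Pi.single i b.elt : Fin r → A) t =
      if t = (i, b) then 1 else 0 := by
    rintro ⟨j, b'⟩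
    rw [coord_single, normalForm_elt, coeff_mon]
    simp only [Prod.mk.injEq]
    by_cases hj : j = i
    · simp only [hj, true_and, if_true]
      congr 1
      exact propext ⟨fun h => Subtype.ext h.symm, fun h => h ▸ rfl⟩
    · simp [hj]
  let rest : Fin r → A := f - a • (Pi.single i b.elt : Fin r → A)
  have hrest : SignedStd.act ψ d.lift rest ∈ W := by
    refine map_mem_of_coord hψ hlt _ _ _ fun j b' hb' => ?_
    have hne : (j, b') ≠ (i, b) := by
      intro he
      rw [he, map_sub, map_smul, Pi.sub_apply, Pi.smul_apply, hsing, if_pos rfl, ← ha] at hb'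
      simp at hb'
    have hlt' : ltF (j, b') (i, b) := by
      refine (hf.2 _ ?_).resolve_left hne
      rwa [map_sub, map_smul, Pi.sub_apply, Pi.smul_apply, hsing, if_neg hne, smul_zero,
        sub_zero] at hb'
    rw [hact]
    rintro ⟨k, w'⟩ hw'
    rw [coord_single] at hw'
    simp only [ne_eq, ite_eq_right_iff, not_forall] at hw'
    obtain ⟨rfl, hw'⟩ := hw'
    obtain ⟨w, hw⟩ := exists_isLMAlg (a := b'.elt * d.elt) hψ hlt (by
      intro h0
      rw [h0, map_zero] at hw'
      exact hw' rfl)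
    have hwu := hltF.mul i k b b' d u w hlt' h hw
    rcases ((isLMAlg_iff hψ hlt).1 hw).2 w'.lift hw' with he | hl
    · rwa [show w' = w from Subtype.ext he]
    · exact _root_.trans (hltF.compat k w w' hl) hwu
  have hu : b.elt * d.elt = u.elt := by
    rw [StdMon.elt, StdMon.elt, ← map_mul, mon_mul_of_comp h, StdMon.elt]
  have hdec : ∀ t, coord hψ hlt (SignedStd.act ψ d.lift f) t =
      coord hψ hlt (SignedStd.act ψ d.lift rest) t +
        a * coord hψ hlt (Pi.single i u.elt : Fin r → A) t := by
    intro t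
    rw [show rest = f - a • (Pi.single i b.elt : Fin r → A) from rfl,
      map_sub (SignedStd.act ψ d.lift), map_smul, hact, hu, map_sub, map_smul]
    simp
  have hirr : coord hψ hlt (SignedStd.act ψ d.lift rest) (i, u) = 0 := by
    by_contra h0
    exact irrefl _ (hrest _ h0)
  rw [isLM_iff hψ hlt]
  refine ⟨?_, fun t ht => ?_⟩
  · rw [hdec, hirr, zero_add, coord_single, if_pos rfl, normalForm_elt, coeff_mon_self, mul_one]
    exact hf.1
  · by_cases h0 : coord hψ hlt (SignedStd.act ψ d.lift rest) t = 0
    · rw [hdec, h0, zero_add] at ht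
      have ht := right_ne_zero_of_mul ht
      rw [coord_single, normalForm_elt] at ht
      simp only [ne_eq, ite_eq_right_iff, not_forall] at ht
      obtain ⟨h1, h2⟩ := ht
      exact Or.inl (Prod.ext h1 (Subtype.ext (eq_of_coeff_mon_ne_zero h2)))
    · exact Or.inr (hrest t h0)

end Free

/-! ### The filtration of the module by signatures -/

section Filtration

variable {K V A : Type*} [Field K] [Quiver V] [Fintype V] [Ring A] [Algebra K A]
  {ψ : PathAlgebra K V →ₐ[K] A} {r m : ℕ}

variable (ψ) in
/-- The image in `A ^ r` of a monomial of `E`. -/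
def evMon (gen : Fin m → Fin r → A) (t : Fin m × PathMon V) : Fin r → A := act ψ t.2 (gen t.1)

variable (ψ) in
/-- The image under `ev` of the span of a set of monomials of `E`. -/
def evSpan (gen : Fin m → Fin r → A) (S : Set (Fin m × PathMon V)) : Submodule K (Fin r → A) :=
  Submodule.span K (evMon ψ gen '' S)

/-- The monomials of `E` that are smaller than `s`. -/
def below (ltE : Fin m × PathMon V → Fin m × PathMon V → Prop) (s : Fin m × PathMon V) :
    Set (Fin m × PathMon V) := {t | ltE t s}

/-- The monomials of `E` that are not greater than `s`. -/
def upTo (ltE : Fin m × PathMon V → Fin m × PathMon V → Prop) (s : Fin m × PathMon V) :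
    Set (Fin m × PathMon V) := {t | t = s ∨ ltE t s}

variable {gen : Fin m → Fin r → A}

theorem evMon_mem_evSpan {S : Set (Fin m × PathMon V)} {t : Fin m × PathMon V} (ht : t ∈ S) :
    evMon ψ gen t ∈ evSpan ψ gen S :=
  Submodule.subset_span (Set.mem_image_of_mem _ ht)

theorem evSpan_mono {S S' : Set (Fin m × PathMon V)} (h : S ⊆ S') :
    evSpan ψ gen S ≤ evSpan ψ gen S' :=
  Submodule.span_mono (Set.image_mono h)

theorem act_evMon {t : Fin m × PathMon V} {q u : PathMon V}
    (h : PathMon.comp t.2 q = some u) : act ψ q (evMon ψ gen t) = evMon ψ gen (t.1, u) :=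
  act_act_of_comp h _

theorem act_mem_evSpan {S S' : Set (Fin m × PathMon V)} {q : PathMon V}
    (h : ∀ t ∈ S, ∀ u, PathMon.comp t.2 q = some u → (t.1, u) ∈ S') {f : Fin r → A}
    (hf : f ∈ evSpan ψ gen S) : act ψ q f ∈ evSpan ψ gen S' := by
  have : evSpan ψ gen S ≤ (evSpan ψ gen S').comap (act ψ q) := by
    refine Submodule.span_le.2 ?_
    rintro _ ⟨t, ht, rfl⟩
    change act ψ q (evMon ψ gen t) ∈ evSpan ψ gen S'
    by_cases hq : t.2.tgt = q.src
    · obtain ⟨u, hu⟩ := PathMon.exists_comp hq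
      rw [act_evMon hu]
      exact evMon_mem_evSpan (h t ht u hu)
    · rw [evMon, act_act_of_ne hq]
      exact zero_mem _
  exact this hf

theorem ev_eq_sum (x : Fin m → PathAlgebra K V) :
    ev ψ gen x = ∑ i, (actHom ψ r).flip (gen i) (x i) := rfl

theorem ev_mem_evSpan {S : Set (Fin m × PathMon V)} {x : Fin m → PathAlgebra K V}
    (h : ∀ i p, (x i).coeff p ≠ 0 → (i, p) ∈ S) : ev ψ gen x ∈ evSpan ψ gen S := by
  rw [ev_eq_sum]
  refine Submodule.sum_mem _ fun i _ => map_mem _ _ _ fun p hp => ?_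
  exact evMon_mem_evSpan (h i p hp)

theorem exists_ev_eq {S : Set (Fin m × PathMon V)} {f : Fin r → A} (hf : f ∈ evSpan ψ gen S) :
    ∃ x : Fin m → PathAlgebra K V, (∀ i p, (x i).coeff p ≠ 0 → (i, p) ∈ S) ∧ ev ψ gen x = f := by
  classical
  induction hf using Submodule.span_induction with
  | mem f hf =>
    obtain ⟨t, ht, rfl⟩ := hf
    refine ⟨Pi.single t.1 (mon K t.2), fun i p hp => ?_, ?_⟩
    · by_cases hi : i = t.1
      · subst hi
        rw [Pi.single_eq_same] at hp
        rwa [eq_of_coeff_mon_ne_zero hp]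
      · rw [Pi.single_eq_of_ne hi] at hp
        exact absurd rfl hp
    · rw [ev_eq_sum, Finset.sum_eq_single t.1]
      · rw [Pi.single_eq_same]; rfl
      · intro i _ hi
        rw [Pi.single_eq_of_ne hi, map_zero]
      · simp
  | zero => exact ⟨0, fun i p hp => absurd rfl hp, by simp [ev_eq_sum]⟩
  | add f g _ _ hf hg =>
    obtain ⟨x, hx, rfl⟩ := hf
    obtain ⟨y, hy, rfl⟩ := hg
    refine ⟨x + y, fun i p hp => ?_, by simp [ev_eq_sum, Finset.sum_add_distrib]⟩
    by_cases h : (x i).coeff p = 0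
    · exact hy i p (by simpa [h] using hp)
    · exact hx i p h
  | smul a f _ hf =>
    obtain ⟨x, hx, rfl⟩ := hf
    refine ⟨a • x, fun i p hp => hx i p ?_, ?_⟩
    · exact right_ne_zero_of_mul (a := a) (by simpa using hp)
    · rw [ev_eq_sum, ev_eq_sum, Finset.smul_sum]
      exact Finset.sum_congr rfl fun i _ => by rw [Pi.smul_apply, map_smul]

omit [Fintype V] in
theorem finite_support_family (x : Fin m → PathAlgebra K V) :
    {t : Fin m × PathMon V | (x t.1).coeff t.2 ≠ 0}.Finite := by
  refine (Set.finite_iUnion fun i => (x i).finite_support.image (Prod.mk i)).subset ?_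
  rintro ⟨i, p⟩ h
  exact Set.mem_iUnion.2 ⟨i, p, h, rfl⟩

theorem finite_deg_lt_free [∀ a b : V, Finite (a ⟶ b)] (N : ℕ) :
    {s : Fin m × PathMon V | s.2.deg < N}.Finite :=
  (Set.finite_univ.prod (PathMon.finite_deg_lt N)).subset fun _ hs => ⟨Set.mem_univ _, hs⟩

theorem evMon_eq_zero {N : ℕ} (hN : ∀ p : PathMon V, N ≤ p.deg → ψ (mon K p) = 0)
    {t : Fin m × PathMon V} (ht : N ≤ t.2.deg) : evMon ψ gen t = 0 := by
  ext i
  rw [evMon, act_apply, hN _ ht, mul_zero]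
  rfl

theorem evSpan_le_deg_lt {N : ℕ} (hN : ∀ p : PathMon V, N ≤ p.deg → ψ (mon K p) = 0)
    (S : Set (Fin m × PathMon V)) : evSpan ψ gen S ≤ evSpan ψ gen {t ∈ S | t.2.deg < N} := by
  refine Submodule.span_le.2 ?_
  rintro _ ⟨t, ht, rfl⟩
  by_cases h : t.2.deg < N
  · exact evMon_mem_evSpan ⟨ht, h⟩
  · rw [evMon_eq_zero hN (not_lt.1 h)]
    exact zero_mem _

variable {ltE : Fin m × PathMon V → Fin m × PathMon V → Prop}

theorem mem_upTo_of_mem_signed {g : (Fin r → A) × (Fin m × PathMon V)}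
    (hg : g ∈ signedElements ψ gen ltE) : g.1 ∈ evSpan ψ gen (upTo ltE g.2) := by
  obtain ⟨_, x, hx, h⟩ := hg
  rw [← h]
  exact ev_mem_evSpan fun i p hp => hx.2 (i, p) hp

theorem mem_signed_of_mem_upTo {f : Fin r → A} {s : Fin m × PathMon V}
    (hf : f ∈ evSpan ψ gen (upTo ltE s)) (hf' : f ∉ evSpan ψ gen (below ltE s)) :
    (f, s) ∈ signedElements ψ gen ltE := by
  obtain ⟨x, hx, rfl⟩ := exists_ev_eq hf
  refine ⟨fun h0 => hf' (by rw [show ev ψ gen x = 0 from h0]; exact zero_mem _), x,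
    ⟨fun h0 => hf' ?_, fun t ht => hx t.1 t.2 ht⟩, rfl⟩
  refine ev_mem_evSpan fun i p hp => (hx i p hp).resolve_left ?_
  rintro rfl
  exact hp h0

theorem exists_signed_of_mem [IsStrictTotalOrder _ ltE] {N : ℕ}
    (hN : ∀ p : PathMon V, N ≤ p.deg → ψ (mon K p) = 0) {S : Set (Fin m × PathMon V)}
    {f : Fin r → A} (hf : f ∈ evSpan ψ gen S) (h0 : f ≠ 0) :
    ∃ s ∈ S, s.2.deg < N ∧ (f, s) ∈ signedElements ψ gen ltE := by
  obtain ⟨x, hx, rfl⟩ := exists_ev_eq (evSpan_le_deg_lt hN S hf)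
  obtain ⟨s, hs⟩ := exists_isLeading ltE (c := fun t : Fin m × PathMon V => (x t.1).coeff t.2)
    (finite_support_family x) (by
      by_contra h
      push Not at h
      refine h0 ?_
      rw [ev_eq_sum]
      refine Finset.sum_eq_zero fun i _ => ?_
      rw [PathAlgebra.ext (x := x i) (y := 0) fun p => h (i, p), map_zero])
  exact ⟨s, (hx _ _ hs.1).1, (hx _ _ hs.1).2, h0, x, hs, rfl⟩

theorem exists_eq_smul_add {f : Fin r → A} {s : Fin m × PathMon V}
    (hf : f ∈ evSpan ψ gen (upTo ltE s)) :
    ∃ (a : K), ∃ h ∈ evSpan ψ gen (below ltE s), f = a • evMon ψ gen s + h := by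
  have : upTo ltE s = insert s (below ltE s) := rfl
  rw [this, evSpan, Set.image_insert_eq, Submodule.mem_span_insert] at hf
  exact hf

theorem act_mem_upTo {lt : PathMon V → PathMon V → Prop} (hltE : IsCompatibleFreeOrder lt ltE)
    {f : Fin r → A} {k : Fin m} {p d u : PathMon V} (hf : f ∈ evSpan ψ gen (upTo ltE (k, p)))
    (h : PathMon.comp p d = some u) : act ψ d f ∈ evSpan ψ gen (upTo ltE (k, u)) := by
  refine act_mem_evSpan (fun t ht w hw => ?_) hf
  rcases ht with rfl | ht
  · exact Or.inl (by rw [Option.some_injective _ (hw.symm.trans h)])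
  · exact Or.inr (hltE.mul k t.1 p t.2 d u w ht h hw)

theorem act_triv_mem_below {f : Fin r → A} {s : Fin m × PathMon V}
    (hf : f ∈ evSpan ψ gen (upTo ltE s)) {v : V} (h : s.2.tgt ≠ v) :
    act ψ (PathMon.triv v) f ∈ evSpan ψ gen (below ltE s) := by
  refine act_mem_evSpan (fun t ht w hw => ?_) hf
  have htv : t.2.tgt = v := (PathMon.comp_eq_some hw).1
  subst htv
  rw [PathMon.comp_triv_self] at hw
  obtain rfl := Option.some_injective _ hw
  exact ht.resolve_left fun he => h (by rw [he])

end Filtration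

/-! ### Reduction -/

section Reduction

variable {K V A : Type*} [Field K] [Quiver V] [Fintype V] [Ring A] [Algebra K A]
  [∀ a b : V, Finite (a ⟶ b)]
  {lt : PathMon V → PathMon V → Prop} {ψ : PathAlgebra K V →ₐ[K] A} {r m : ℕ}
  {ltF : Fin r × StdMon lt ψ → Fin r × StdMon lt ψ → Prop}
  {ltE : Fin m × PathMon V → Fin m × PathMon V → Prop}
  {gen : Fin m → Fin r → A} {G : Set ((Fin r → A) × (Fin m × PathMon V))}
  (hψ : IsBasicPresentation ψ) (hlt : IsMonomialOrder lt)

include hψ hlt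

theorem isLMAlg_elt_iff {b t : StdMon lt ψ} : IsLMAlg lt ψ b.elt t ↔ t = b := by
  rw [isLMAlg_iff hψ hlt, normalForm_elt]
  constructor
  · exact fun h => Subtype.ext (eq_of_coeff_mon_ne_zero h.1)
  · rintro rfl
    exact ⟨by simp, fun p hp => Or.inl (eq_of_coeff_mon_ne_zero hp)⟩

theorem IsSmallCofactor.divides {b c t : StdMon lt ψ} (h : IsSmallCofactor b c)
    (ht : b.elt * c.elt = t.elt) : PathMon.Divides b.lift t.lift := by
  by_contra hd
  exact h (Or.inl ⟨t, by rw [ht]; exact (isLMAlg_elt_iff hψ hlt).2 rfl, hd⟩)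

theorem isSmallCofactor_of_comp {b c u : StdMon lt ψ}
    (h : PathMon.comp b.lift c.lift = some u.lift) : IsSmallCofactor b c := by
  have hu : b.elt * c.elt = u.elt := by
    rw [StdMon.elt, StdMon.elt, ← map_mul, mon_mul_of_comp h, StdMon.elt]
  rintro (⟨t, ht, hd⟩ | h0)
  · rw [hu, isLMAlg_elt_iff hψ hlt] at ht
    exact hd ⟨c.lift, ht ▸ h⟩
  · exact StdMon.elt_ne_zero hψ hlt u (hu ▸ h0)

omit hψ [∀ a b : V, Finite (a ⟶ b)] in
theorem exists_triv_cofactor (b : StdMon lt ψ) :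
    ∃ e : StdMon lt ψ, e.lift = PathMon.triv b.lift.tgt :=
  ⟨⟨_, IsStandard.of_comp hlt b.2 (PathMon.comp_triv_self b.lift)⟩, rfl⟩

/-- Cancelling the leading monomial of `f` by a multiple of `h`. -/
theorem exists_smul_cancel {f h : Fin r → A} {τ : Fin r × StdMon lt ψ} (hf : IsLM ltF f τ)
    (hh : IsLM ltF h τ) : ∃ a : K, ∀ t, coord hψ hlt (f - a • h) t ≠ 0 → ltF t τ := by
  rw [isLM_iff hψ hlt] at hf hh
  refine ⟨coord hψ hlt f τ / coord hψ hlt h τ, fun t ht => ?_⟩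
  rw [map_sub, map_smul, Pi.sub_apply, Pi.smul_apply, smul_eq_mul] at ht
  have htτ : t ≠ τ := by
    rintro rfl
    exact ht (by rw [div_mul_cancel₀ _ hh.1, sub_self])
  by_cases h0 : coord hψ hlt f t = 0
  · refine (hh.2 t fun h1 => ht ?_).resolve_left htτ
    rw [h0, h1, mul_zero, sub_zero]
  · exact (hf.2 t h0).resolve_left htτ

theorem IsLM.add_smul {f h : Fin r → A} {τ τ' : Fin r × StdMon lt ψ} (hltF : IsCompatibleOrder ltF)
    (hf : IsLM ltF f τ) (hh : IsLM ltF h τ') (hlt' : ltF τ' τ) (a : K) :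
    IsLM ltF (f + a • h) τ := by
  have := hltF.total
  rw [isLM_iff hψ hlt] at hf hh ⊢
  have hsmall : ∀ t, coord hψ hlt h t ≠ 0 → ltF t τ := fun t ht => by
    rcases hh.2 t ht with rfl | h'
    · exact hlt'
    · exact _root_.trans h' hlt'
  have h0 : coord hψ hlt h τ = 0 := by
    by_contra h0
    exact irrefl _ (hsmall τ h0)
  refine ⟨?_, fun t ht => ?_⟩
  · rw [map_add, map_smul, Pi.add_apply, Pi.smul_apply, h0, smul_zero, add_zero]
    exact hf.1
  · by_cases h1 : coord hψ hlt f t = 0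
    · refine Or.inr (hsmall t fun h2 => ht ?_)
      rw [map_add, map_smul, Pi.add_apply, Pi.smul_apply, h1, h2, smul_zero, add_zero]
    · exact hf.2 t h1

/-- A nonzero class modulo the subspace `W` has a representative whose leading monomial is not one
of an element of `W`. -/
theorem exists_reduced (hltF : IsCompatibleOrder ltF) {W : Submodule K (Fin r → A)}
    {f : Fin r → A} (hf : f ∉ W) :
    ∃ f', f - f' ∈ W ∧ ∀ τ, IsLM ltF f' τ → ∀ h ∈ W, ¬ IsLM ltF h τ := by
  have := hltF.total
  have : Finite (StdMon lt ψ) := hψ.finite_stdMon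
  have hne : ∀ f', f - f' ∈ W → f' ≠ 0 := by
    rintro f' h rfl
    exact hf (by simpa using h)
  obtain ⟨τ₀, hτ₀⟩ := exists_isLM hψ hlt hltF (hne f (by simp))
  obtain ⟨τ, ⟨f', hf', hτ⟩, hmin⟩ := exists_least ltF
    (S := {τ | ∃ f', f - f' ∈ W ∧ IsLM ltF f' τ}) (Set.toFinite _) ⟨τ₀, f, by simp, hτ₀⟩
  refine ⟨f', hf', fun τ' hτ' h hh hhτ => ?_⟩
  obtain rfl := IsLM.unique hψ hlt hltF hτ hτ'
  obtain ⟨a, ha⟩ := exists_smul_cancel hψ hlt hτ hhτ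
  have hW : f - (f' - a • h) ∈ W := by
    rw [← sub_add]
    exact W.add_mem hf' (W.smul_mem a hh)
  obtain ⟨σ, hσ⟩ := exists_isLM hψ hlt hltF (hne _ hW)
  have hlt' := ha σ ((isLM_iff hψ hlt).1 hσ).1
  rcases hmin σ ⟨_, hW, hσ⟩ with rfl | h'
  · exact irrefl _ hlt'
  · exact irrefl _ (_root_.trans hlt' h')

/-- A reduction of `f` by the signed element `g` and a small cofactor `c` yields an element with
the leading monomial of `f` and with signature at most `σ(g) c`. -/
theorem exists_of_reduction (hltF : IsCompatibleOrder ltF) (hltE : IsCompatibleFreeOrder lt ltE)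
    {g : (Fin r → A) × (Fin m × PathMon V)} (hg : g ∈ signedElements ψ gen ltE) {i : Fin r}
    {b c t : StdMon lt ψ} {u : PathMon V} (hb : IsLM ltF g.1 (i, b)) (hc : IsSmallCofactor b c)
    (ht : b.elt * c.elt = t.elt) (hu : PathMon.comp g.2.2 c.lift = some u) :
    ∃ h ∈ evSpan ψ gen (upTo ltE (g.2.1, u)), IsLM ltF h (i, t) := by
  have := hltE.total
  obtain ⟨d, hd, hsrc, htgt, hdc⟩ := exists_cofactor_le hlt
    (StdMon.elt_ne_zero hψ hlt) ht (IsSmallCofactor.divides hψ hlt hc ht)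
  have hu' := PathMon.comp_eq_some hu
  obtain ⟨u', hu₂⟩ := PathMon.exists_comp (p := g.2.2) (q := d.lift) (hu'.1.trans hsrc.symm)
  have hle : u' = u ∨ ltE (g.2.1, u') (g.2.1, u) := by
    rcases hdc with rfl | hdc
    · exact Or.inl (Option.some_injective _ (hu₂.symm.trans hu))
    · refine Or.inr (hltE.compat _ _ _ (hlt.mul c.lift d.lift (PathMon.triv c.lift.tgt) g.2.2
        c.lift d.lift u u' hdc (PathMon.comp_triv_self _) ?_ hu hu₂).2)
      rw [← htgt]
      exact PathMon.comp_triv_self _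
  refine ⟨act ψ d.lift g.1, evSpan_mono ?_ (act_mem_upTo hltE (mem_upTo_of_mem_signed hg) hu₂),
    IsLM.act hψ hlt hltF hb hd⟩
  rintro w (rfl | hw)
  · rcases hle with rfl | hle
    · exact Or.inl rfl
    · exact Or.inr hle
  · rcases hle with rfl | hle
    · exact Or.inr hw
    · exact Or.inr (_root_.trans hw hle)

theorem not_sReducible (hltF : IsCompatibleOrder ltF) (hltE : IsCompatibleFreeOrder lt ltE)
    {f : Fin r → A} {s : Fin m × PathMon V}
    (h : ∀ τ, IsLM ltF f τ → ∀ h ∈ evSpan ψ gen (below ltE s), ¬ IsLM ltF h τ) :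
    ¬ SReducible ltF ltE (signedElements ψ gen ltE) f s := by
  have := hltE.total
  rintro ⟨g, hg, i, b, c, t, u, hb, hc, hf, ht, hu, hlt'⟩
  obtain ⟨h', hh', hLM⟩ := exists_of_reduction hψ hlt hltF hltE hg hb hc ht hu
  refine h _ hf h' (evSpan_mono ?_ hh') hLM
  rintro w (rfl | hw)
  · exact hlt'
  · exact _root_.trans hw hlt'

/-- Every step of the signature filtration is accounted for by a multiple of an element of a
signed standard basis. -/
theorem IsSignedStandardBasis.exists_signature (hltF : IsCompatibleOrder ltF)
    (hltE : IsCompatibleFreeOrder lt ltE) (hG : IsSignedStandardBasis gen ltF ltE G)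
    {s : Fin m × PathMon V} {f : Fin r → A} (hf : f ∈ evSpan ψ gen (upTo ltE s))
    (hf' : f ∉ evSpan ψ gen (below ltE s)) :
    ∃ g ∈ G, ∃ (c u : PathMon V), PathMon.comp g.2.2 c = some u ∧ (g.2.1, u) = s := by
  have := hltE.total
  have hle : evSpan ψ gen (below ltE s) ≤ evSpan ψ gen (upTo ltE s) := evSpan_mono fun _ => Or.inr
  obtain ⟨f', hff', hirr⟩ := exists_reduced hψ hlt hltF hf'
  have h1 : f' ∈ evSpan ψ gen (upTo ltE s) := by
    have := sub_mem hf (hle hff')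
    rwa [sub_sub_cancel] at this
  have h2 : f' ∉ evSpan ψ gen (below ltE s) := fun h => hf' (by
    have := add_mem hff' h
    rwa [sub_add_cancel] at this)
  obtain ⟨g, hg, i, b, c, t, u, hb, hc, hf, ht, hu, hus⟩ :=
    hG.reduces _ (mem_signed_of_mem_upTo h1 h2) (not_sReducible hψ hlt hltF hltE hirr)
  refine ⟨g, hg, c.lift, u, hu, hus.resolve_right fun hlt' => ?_⟩
  obtain ⟨h', hh', hLM⟩ := exists_of_reduction hψ hlt hltF hltE (hG.signed hg) hb hc ht hu
  refine hirr _ hf h' (evSpan_mono ?_ hh') hLM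
  rintro w (rfl | hw)
  · exact hlt'
  · exact _root_.trans hw hlt'

/-- If a leading monomial occurs with a signature below `σ`, then it occurs with a least one. -/
theorem exists_least_signature (hltE : IsCompatibleFreeOrder lt ltE) {σ : Fin m × PathMon V}
    {τ : Fin r × StdMon lt ψ} {h : Fin r → A} (hh : h ∈ evSpan ψ gen (below ltE σ))
    (hhτ : IsLM ltF h τ) :
    ∃ s, ltE s σ ∧ (∃ h' ∈ evSpan ψ gen (upTo ltE s), IsLM ltF h' τ) ∧
      ∀ h' ∈ evSpan ψ gen (below ltE s), ¬ IsLM ltF h' τ := by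
  have := hltE.total
  obtain ⟨N, hN⟩ := hψ.long_paths
  let S : Set (Fin m × PathMon V) :=
    {s | s.2.deg < N ∧ ltE s σ ∧ ∃ h ∈ evSpan ψ gen (upTo ltE s), IsLM ltF h τ}
  have hS : ∀ s h, h ∈ evSpan ψ gen (below ltE s) → IsLM ltF h τ → (s = σ ∨ ltE s σ) →
      ∃ s' ∈ S, ltE s' s := by
    intro s h hh hhτ hs
    obtain ⟨s', h1, h2, h3⟩ := exists_signed_of_mem (ltE := ltE) hN hh (IsLM.ne_zero hψ hlt hhτ)
    have h1' : ltE s' s := h1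
    have h4 : ltE s' σ := by
      rcases hs with rfl | hs
      · exact h1'
      · exact _root_.trans h1' hs
    have h5 := mem_upTo_of_mem_signed h3
    exact ⟨s', ⟨h2, h4, h, h5, hhτ⟩, h1'⟩
  obtain ⟨s₀, hs₀, -⟩ := hS σ h hh hhτ (Or.inl rfl)
  obtain ⟨s, hs, hmin⟩ := exists_least ltE (S := S)
    ((finite_deg_lt_free N).subset fun s hs => hs.1) ⟨s₀, hs₀⟩
  refine ⟨s, hs.2.1, hs.2.2, fun h' hh' hτ' => ?_⟩
  obtain ⟨s', hs', hlt'⟩ := hS s h' hh' hτ' (Or.inr hs.2.1)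
  rcases hmin s' hs' with rfl | h4
  · exact irrefl _ hlt'
  · exact irrefl _ (_root_.trans hlt' h4)

/-- In an interreduced signed standard basis, the leading monomial of an element does not occur
with a smaller signature: an element with this leading monomial and least signature is
irreducible, so it is reduced by an element of the basis, which would then reduce the given one. -/
theorem IsSignedStandardBasis.not_isLM_below (hltF : IsCompatibleOrder ltF)
    (hltE : IsCompatibleFreeOrder lt ltE) (hG : IsSignedStandardBasis gen ltF ltE G)
    (hred : IsInterreduced ltF ltE G) {g : (Fin r → A) × (Fin m × PathMon V)} (hg : g ∈ G)
    {τ : Fin r × StdMon lt ψ} (hτ : IsLM ltF g.1 τ) {h : Fin r → A}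
    (hh : h ∈ evSpan ψ gen (below ltE g.2)) : ¬ IsLM ltF h τ := by
  have := hltE.total
  intro hhτ
  obtain ⟨s, hsg, ⟨h', hh', hh'τ⟩, hno⟩ := exists_least_signature hψ hlt hltE hh hhτ
  have hirr : ∀ τ', IsLM ltF h' τ' → ∀ h'' ∈ evSpan ψ gen (below ltE s), ¬ IsLM ltF h'' τ' := by
    intro τ' hτ'
    rw [← IsLM.unique hψ hlt hltF hh'τ hτ']
    exact hno
  obtain ⟨g', hg', i, b, c, t, u, hb, hc, hf, ht, hu, hus⟩ :=
    hG.reduces _ (mem_signed_of_mem_upTo hh' fun hm => hno h' hm hh'τ)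
      (not_sReducible hψ hlt hltF hltE hirr)
  obtain rfl := IsLM.unique hψ hlt hltF hf hh'τ
  refine (hred g hg).1 ⟨g', hg', i, b, c, t, u, hb, hc, hτ, ht, hu, ?_⟩
  rcases hus with h1 | h1
  · rwa [h1]
  · exact _root_.trans h1 hsg

theorem IsSignedStandardBasis.notMem_below (hltF : IsCompatibleOrder ltF)
    (hltE : IsCompatibleFreeOrder lt ltE) (hG : IsSignedStandardBasis gen ltF ltE G)
    (hred : IsInterreduced ltF ltE G) {g : (Fin r → A) × (Fin m × PathMon V)} (hg : g ∈ G) :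
    g.1 ∉ evSpan ψ gen (below ltE g.2) := by
  intro h
  obtain ⟨τ, hτ⟩ := exists_isLM hψ hlt hltF (hG.signed hg).1
  exact hG.not_isLM_below hψ hlt hltF hltE hred hg hτ h hτ

/-- In an interreduced signed standard basis, leading monomials end where the signatures end:
otherwise multiplication by a trivial path would lower the signature and keep the leading
monomial. -/
theorem IsSignedStandardBasis.tgt_eq (hltF : IsCompatibleOrder ltF)
    (hltE : IsCompatibleFreeOrder lt ltE) (hG : IsSignedStandardBasis gen ltF ltE G)
    (hred : IsInterreduced ltF ltE G) {g : (Fin r → A) × (Fin m × PathMon V)} (hg : g ∈ G)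
    {i : Fin r} {b : StdMon lt ψ} (hb : IsLM ltF g.1 (i, b)) : g.2.2.tgt = b.lift.tgt := by
  by_contra hne
  obtain ⟨e, he⟩ := exists_triv_cofactor hlt b
  have h1 := IsLM.act hψ hlt hltF (d := e) (u := b) hb (by rw [he]; exact PathMon.comp_triv_self _)
  rw [he] at h1
  exact hG.not_isLM_below hψ hlt hltF hltE hred hg hb
    (act_triv_mem_below (mem_upTo_of_mem_signed (hG.signed hg)) hne) h1

theorem IsSignedStandardBasis.not_lt_of_signature_eq (hltF : IsCompatibleOrder ltF)
    (hltE : IsCompatibleFreeOrder lt ltE) (hG : IsSignedStandardBasis gen ltF ltE G)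
    (hred : IsInterreduced ltF ltE G) {g g' : (Fin r → A) × (Fin m × PathMon V)} (hg : g ∈ G)
    (hg' : g' ∈ G) (hs : g.2 = g'.2) {τ τ' : Fin r × StdMon lt ψ} (hτ : IsLM ltF g.1 τ)
    (hτ' : IsLM ltF g'.1 τ') : ¬ ltF τ τ' := by
  intro hlt'
  obtain ⟨a, h, hh, hgh⟩ := exists_eq_smul_add (mem_upTo_of_mem_signed (hG.signed hg))
  obtain ⟨a', h', hh', hgh'⟩ := exists_eq_smul_add (mem_upTo_of_mem_signed (hG.signed hg'))
  have ha : a ≠ 0 := by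
    rintro rfl
    rw [zero_smul, zero_add] at hgh
    exact hG.notMem_below hψ hlt hltF hltE hred hg (hgh ▸ hh)
  refine hG.not_isLM_below hψ hlt hltF hltE hred hg' hτ' (h := g'.1 + (-(a' / a)) • g.1) ?_
    (IsLM.add_smul hψ hlt hltF hτ' hτ hlt' _)
  have : g'.1 + (-(a' / a)) • g.1 = h' - (a' / a) • h := by
    rw [hgh, hgh', hs, smul_add, smul_smul, neg_mul, div_mul_cancel₀ _ ha]
    module
  rw [this]
  exact sub_mem hh' (Submodule.smul_mem _ _ (hs ▸ hh))

theorem IsSignedStandardBasis.signature_injOn (hltF : IsCompatibleOrder ltF)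
    (hltE : IsCompatibleFreeOrder lt ltE) (hG : IsSignedStandardBasis gen ltF ltE G)
    (hred : IsInterreduced ltF ltE G) : Set.InjOn Prod.snd G := by
  have := hltF.total
  intro g hg g' hg' hs
  obtain ⟨⟨i, b⟩, hτ⟩ := exists_isLM hψ hlt hltF (hG.signed hg).1
  obtain ⟨τ', hτ'⟩ := exists_isLM hψ hlt hltF (hG.signed hg').1
  rcases trichotomous_of ltF (i, b) τ' with h | rfl | h
  · exact absurd h (hG.not_lt_of_signature_eq hψ hlt hltF hltE hred hg hg' hs hτ hτ')
  · by_contra hne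
    obtain ⟨e, he⟩ := exists_triv_cofactor hlt b
    have hbe : PathMon.comp b.lift e.lift = some b.lift := by
      rw [he]; exact PathMon.comp_triv_self _
    refine (hred g hg).2 ⟨g', ⟨hg', fun h => hne h.symm⟩, i, b, e, b, g'.2.2, hτ',
      isSmallCofactor_of_comp hψ hlt hbe, hτ, ?_, ?_, hs.symm⟩
    · rw [StdMon.elt, StdMon.elt, ← map_mul, mon_mul_of_comp hbe]
    · rw [he, ← hG.tgt_eq hψ hlt hltF hltE hred hg' hτ']
      exact PathMon.comp_triv_self _
  · exact absurd h (hG.not_lt_of_signature_eq hψ hlt hltF hltE hred hg' hg hs.symm hτ' hτ)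

end Reduction

/-! ### The radical of the module -/

section Radical

variable {K V A : Type*} [Field K] [Quiver V] [Fintype V] [Ring A] [Algebra K A]
  {ψ : PathAlgebra K V →ₐ[K] A} {r m : ℕ} {gen : Fin m → Fin r → A}

variable (ψ) in
/-- The image under `ev` of the monomials of `E` of degree at least `n`. This is `M J ^ n` for the
ideal `J` of `A` generated by the arrows. -/
def degSpan (gen : Fin m → Fin r → A) (n : ℕ) : Submodule K (Fin r → A) :=
  evSpan ψ gen {t | n ≤ t.2.deg}

theorem degSpan_antitone : Antitone (degSpan ψ gen) :=
  fun _ _ h => evSpan_mono fun _ ht => le_trans h ht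

theorem act_mem_degSpan {n : ℕ} {f : Fin r → A} (hf : f ∈ degSpan ψ gen n) (p : PathMon V) :
    act ψ p f ∈ degSpan ψ gen (n + p.deg) := by
  refine act_mem_evSpan (fun t ht u hu => ?_) hf
  have := (PathMon.comp_eq_some hu).2.2.2
  change n + p.deg ≤ u.deg
  have : n ≤ t.2.deg := ht
  omega

theorem op_smul_mem_degSpan (hψ : IsBasicPresentation ψ) {n : ℕ} {f : Fin r → A}
    (hf : f ∈ degSpan ψ gen n) (a : Aᵐᵒᵖ) : a • f ∈ degSpan ψ gen n :=
  op_smul_mem hψ.surjective (fun p => degSpan_antitone (Nat.le_add_right _ _)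
    (act_mem_degSpan hf p)) a

theorem mem_span_iff (hψ : IsBasicPresentation ψ) {f : Fin r → A} :
    f ∈ Submodule.span Aᵐᵒᵖ (Set.range gen) ↔ f ∈ degSpan ψ gen 0 := by
  constructor
  · intro hf
    induction hf using Submodule.span_induction with
    | mem f hf =>
      obtain ⟨i, rfl⟩ := hf
      rw [← sum_act_triv (ψ := ψ) (gen i)]
      exact Submodule.sum_mem _ fun v _ => evMon_mem_evSpan (t := (i, _)) (Nat.zero_le _)
    | zero => exact zero_mem _
    | add f g _ _ hf hg => exact add_mem hf hg
    | smul a f _ hf => exact op_smul_mem_degSpan hψ hf a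
  · intro hf
    have : degSpan ψ gen 0 ≤ (Submodule.span Aᵐᵒᵖ (Set.range gen)).restrictScalars K := by
      refine Submodule.span_le.2 ?_
      rintro _ ⟨t, -, rfl⟩
      exact Submodule.smul_mem _ _ (Submodule.subset_span (Set.mem_range_self t.1))
    exact this hf

/-- Nakayama's lemma for the nilpotent ideal generated by the arrows. -/
theorem degSpan_zero_le (hψ : IsBasicPresentation ψ) {U : Submodule Aᵐᵒᵖ (Fin r → A)}
    (hU : ∀ f ∈ degSpan ψ gen 0, ∃ g ∈ U, f - g ∈ degSpan ψ gen 1) :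
    degSpan ψ gen 0 ≤ U.restrictScalars K := by
  obtain ⟨N, hN⟩ := hψ.long_paths
  have key : ∀ k n, N ≤ n + k → degSpan ψ gen n ≤ U.restrictScalars K := by
    intro k
    induction k with
    | zero =>
      intro n hn
      refine Submodule.span_le.2 ?_
      rintro _ ⟨t, ht, rfl⟩
      rw [evMon_eq_zero hN (le_trans hn ht)]
      exact zero_mem _
    | succ k ih =>
      intro n hn
      have hsucc := ih (n + 1) (by omega)
      refine Submodule.span_le.2 ?_
      rintro _ ⟨⟨i, p⟩, ht, rfl⟩
      have ht : n ≤ p.deg := ht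
      have h0 : act ψ p (evMon ψ gen (i, PathMon.triv p.src)) = evMon ψ gen (i, p) :=
        act_evMon (PathMon.triv_comp_self p)
      obtain ⟨g, hg, hfg⟩ := hU (evMon ψ gen (i, PathMon.triv p.src))
        (evMon_mem_evSpan (Nat.zero_le _))
      have h1 : act ψ p (evMon ψ gen (i, PathMon.triv p.src) - g) ∈ U.restrictScalars K :=
        hsucc (degSpan_antitone (by omega) (act_mem_degSpan hfg p))
      have h2 : act ψ p g ∈ U.restrictScalars K := U.smul_mem _ hg
      have h3 := add_mem h1 h2
      rwa [map_sub, sub_add_cancel, h0] at h3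
  exact key N 0 (by omega)

/-- `M J` is contained in the radical of `M`, by Nakayama's lemma. -/
theorem mem_jacobson_of_mem_degSpan (hψ : IsBasicPresentation ψ) {M : Submodule Aᵐᵒᵖ (Fin r → A)}
    (hM : ∀ f, f ∈ M ↔ f ∈ degSpan ψ gen 0) {x : M} (hx : x.1 ∈ degSpan ψ gen 1) :
    x ∈ Module.jacobson Aᵐᵒᵖ M := by
  rw [Module.jacobson, Submodule.mem_sInf]
  intro U hU
  by_contra hxU
  let J : Submodule Aᵐᵒᵖ M :=
    { carrier := {y | y.1 ∈ degSpan ψ gen 1}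
      zero_mem' := (degSpan ψ gen 1).zero_mem
      add_mem' := fun h h' => (degSpan ψ gen 1).add_mem h h'
      smul_mem' := fun a _ h => op_smul_mem_degSpan hψ h a }
  have htop : U ⊔ J = ⊤ := hU.2 _ (left_lt_sup.2 fun h => hxU (h hx))
  have hle : degSpan ψ gen 0 ≤ (U.map M.subtype).restrictScalars K := by
    refine degSpan_zero_le hψ fun f hf => ?_
    have hf' : (⟨f, (hM f).2 hf⟩ : M) ∈ U ⊔ J := htop ▸ Submodule.mem_top
    obtain ⟨g, hg, j, hj, hgj⟩ := Submodule.mem_sup.1 hf'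
    refine ⟨g.1, Submodule.mem_map_of_mem hg, ?_⟩
    have : f = g.1 + j.1 := (congrArg Subtype.val hgj).symm
    rw [this, add_sub_cancel_left]
    exact hj
  refine hU.1 (eq_top_iff.2 fun y _ => ?_)
  obtain ⟨z, hz, hzy⟩ := hle ((hM _).1 y.2)
  rwa [← Subtype.ext (a1 := z) (a2 := y) hzy]

/-- The radical of `M` is contained in `M J`: if `f 1ᵥ` is not in `M J`, then a linear form `φ` that
vanishes on `M J` but not at `f 1ᵥ` defines the maximal submodule of all `x` with `φ (x 1ᵥ) = 0`. -/
theorem mem_degSpan_of_mem_jacobson (hψ : IsBasicPresentation ψ)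
    {M : Submodule Aᵐᵒᵖ (Fin r → A)} (hM : ∀ f, f ∈ M ↔ f ∈ degSpan ψ gen 0) {f : M}
    (hf : f ∈ Module.jacobson Aᵐᵒᵖ M) : f.1 ∈ degSpan ψ gen 1 := by
  by_contra hfJ
  obtain ⟨v, hv⟩ : ∃ v, act ψ (PathMon.triv v) f.1 ∉ degSpan ψ gen 1 := by
    by_contra h
    push Not at h
    refine hfJ ?_
    rw [← sum_act_triv (ψ := ψ) f.1]
    exact Submodule.sum_mem _ fun v _ => h v
  obtain ⟨φ, hφ, hφJ⟩ := Submodule.exists_le_ker_of_notMem hv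
  let χ : (Fin r → A) →ₗ[K] K := φ.comp (act ψ (PathMon.triv v))
  have hχ : ∀ x ∈ degSpan ψ gen 0, χ x = 0 → ∀ p, χ (act ψ p x) = 0 := by
    intro x hx h0 p
    by_cases hp : p.deg = 0
    · rw [PathMon.eq_triv_of_deg_eq_zero hp]
      by_cases hw : p.tgt = v
      · rw [hw]
        change φ (act ψ _ (act ψ _ x)) = 0
        rwa [act_act_of_comp (show PathMon.comp (PathMon.triv v) (PathMon.triv v) = _ from
          PathMon.comp_triv_self (PathMon.triv v))]
      · change φ (act ψ _ (act ψ _ x)) = 0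
        rw [act_act_of_ne (by exact hw), map_zero]
    · refine hφJ (degSpan_antitone ?_ (act_mem_degSpan (act_mem_degSpan hx p) _))
      omega
  let U : Submodule Aᵐᵒᵖ M :=
    { carrier := {x | χ x.1 = 0}
      zero_mem' := map_zero χ
      add_mem' := fun {x y} hx hy => by
        change χ (x.1 + y.1) = 0
        rw [map_add, show χ x.1 = 0 from hx, show χ y.1 = 0 from hy, add_zero]
      smul_mem' := fun a x hx =>
        op_smul_mem (W := LinearMap.ker χ) hψ.surjective (hχ x.1 ((hM _).1 x.2) hx) a }
  have hU : IsCoatom U := by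
    refine ⟨fun h => hφ (show f ∈ U from h ▸ Submodule.mem_top), fun U' hU' => ?_⟩
    obtain ⟨y, hy, hyU⟩ := Set.exists_of_ssubset hU'
    have hy0 : χ y.1 ≠ 0 := hyU
    refine eq_top_iff.2 fun z _ => ?_
    have hz : z - (χ z.1 / χ y.1) • y ∈ U := by
      change χ (z.1 - (χ z.1 / χ y.1) • y.1) = 0
      rw [map_sub, map_smul, smul_eq_mul, div_mul_cancel₀ _ hy0, sub_self]
    have hy' : (χ z.1 / χ y.1) • y ∈ U' := (U'.restrictScalars K).smul_mem _ hy
    have := U'.add_mem (hU'.le hz) hy'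
    rwa [sub_add_cancel] at this
  rw [Module.jacobson, Submodule.mem_sInf] at hf
  exact hφ (hf U hU)

end Radical

/-! ### The elements whose signature has degree zero -/

section DegreeZero

variable {K V A : Type*} [Field K] [Quiver V] [Fintype V] [Ring A] [Algebra K A]
  {lt : PathMon V → PathMon V → Prop} {ψ : PathAlgebra K V →ₐ[K] A} {r m : ℕ}
  {ltF : Fin r × StdMon lt ψ → Fin r × StdMon lt ψ → Prop}
  {ltE : Fin m × PathMon V → Fin m × PathMon V → Prop}
  {gen : Fin m → Fin r → A} {G : Set ((Fin r → A) × (Fin m × PathMon V))}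

/-- Since the ordering is a negative degree ordering, `M J` lies below every monomial of degree
zero. -/
theorem degSpan_one_le_below (hneg : IsNegativeDegreeOrder ltE) {s : Fin m × PathMon V}
    (hs : s.2.deg = 0) : degSpan ψ gen 1 ≤ evSpan ψ gen (below ltE s) :=
  evSpan_mono fun t ht => hneg t s (by have : 1 ≤ t.2.deg := ht; omega)

/-- For uniform `f ∈ T`, the `A`-submodule generated by `T` is the span of `T` modulo `M J`. -/
theorem mem_sup_of_mem_span (hψ : IsBasicPresentation ψ) {T : Set (Fin r → A)}
    (hTM : T ⊆ degSpan ψ gen 0) (hT : ∀ f ∈ T, IsUniform ψ f) {f : Fin r → A}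
    (hf : f ∈ Submodule.span Aᵐᵒᵖ T) : f ∈ Submodule.span K T ⊔ degSpan ψ gen 1 := by
  have hact : ∀ p, Submodule.span K T ⊔ degSpan ψ gen 1 ≤
      (Submodule.span K T ⊔ degSpan ψ gen 1).comap (act ψ p) := by
    intro p
    refine sup_le (Submodule.span_le.2 fun f hf => ?_) fun f hf => ?_
    · change act ψ p f ∈ Submodule.span K T ⊔ degSpan ψ gen 1
      by_cases hp : p.deg = 0
      · obtain ⟨v, hv⟩ := hT f hf
        rw [← act_eq_smul] at hv
        rw [PathMon.eq_triv_of_deg_eq_zero hp]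
        by_cases hpv : v = p.tgt
        · rw [← hpv, hv]
          exact Submodule.mem_sup_left (Submodule.subset_span hf)
        · rw [← hv, act_act_of_ne (by exact hpv)]
          exact zero_mem _
      · exact Submodule.mem_sup_right
          (degSpan_antitone (by omega) (act_mem_degSpan (hTM hf) p))
    · exact Submodule.mem_sup_right (degSpan_antitone (by omega) (act_mem_degSpan hf p))
  induction hf using Submodule.span_induction with
  | mem f hf => exact Submodule.mem_sup_left (Submodule.subset_span hf)
  | zero => exact zero_mem _
  | add f g _ _ hf hg => exact add_mem hf hg
  | smul a f _ hf => exact op_smul_mem hψ.surjective (fun p => hact p hf) a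

variable [∀ a b : V, Finite (a ⟶ b)]

/-- The elements of `G` with signature of degree zero span `M` modulo `M J`. -/
theorem IsSignedStandardBasis.degSpan_zero_le_sup (hψ : IsBasicPresentation ψ)
    (hlt : IsMonomialOrder lt) (hltF : IsCompatibleOrder ltF)
    (hltE : IsCompatibleFreeOrder lt ltE) (hG : IsSignedStandardBasis gen ltF ltE G)
    (hred : IsInterreduced ltF ltE G) :
    degSpan ψ gen 0 ≤ Submodule.span K (Prod.fst '' degreeZero G) ⊔ degSpan ψ gen 1 := by
  have := hltE.total
  set W := Submodule.span K (Prod.fst '' degreeZero G) ⊔ degSpan ψ gen 1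
  have hpos : ∀ t : Fin m × PathMon V, evMon ψ gen t ∉ W → t.2.deg < 1 := by
    intro t ht
    by_contra h
    exact ht (Submodule.mem_sup_right (evMon_mem_evSpan (not_lt.1 h)))
  refine Submodule.span_le.2 ?_
  rintro _ ⟨t, -, rfl⟩
  by_contra ht
  obtain ⟨s, hs, hmin⟩ := exists_least ltE (S := {t | evMon ψ gen t ∉ W})
    ((finite_deg_lt_free 1).subset hpos) ⟨t, ht⟩
  have hs : evMon ψ gen s ∉ W := hs
  have hbelow : evSpan ψ gen (below ltE s) ≤ W := by
    refine Submodule.span_le.2 ?_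
    rintro _ ⟨t, hts, rfl⟩
    have hts : ltE t s := hts
    by_contra ht
    rcases hmin t ht with rfl | h
    · exact irrefl _ hts
    · exact irrefl _ (_root_.trans hts h)
  obtain ⟨g, hg, c, u, hu, rfl⟩ := hG.exists_signature hψ hlt hltF hltE
    (s := s) (evMon_mem_evSpan (Or.inl rfl)) fun h => hs (hbelow h)
  have hdeg := hpos _ hs
  have hu' := PathMon.comp_eq_some hu
  have hcu : u = g.2.2 := by
    rw [PathMon.eq_triv_of_deg_eq_zero (p := c) (by change u.deg < 1 at hdeg; omega)] at hu
    rw [show PathMon.triv c.tgt = PathMon.triv g.2.2.tgt by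
      rw [(PathMon.comp_eq_some hu).1]; rfl, PathMon.comp_triv_self] at hu
    exact (Option.some_injective _ hu).symm
  subst hcu
  have hgW : g.1 ∈ W := Submodule.mem_sup_left
    (Submodule.subset_span ⟨g, ⟨hg, by change g.2.2.deg < 1 at hdeg; omega⟩, rfl⟩)
  obtain ⟨a, h, hh, hgh⟩ := exists_eq_smul_add (mem_upTo_of_mem_signed (hG.signed hg))
  have ha : a ≠ 0 := by
    rintro rfl
    rw [zero_smul, zero_add] at hgh
    exact hG.notMem_below hψ hlt hltF hltE hred hg (hgh ▸ hh)
  have h1 : a • evMon ψ gen g.2 ∈ W := by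
    have := sub_mem hgW (hbelow hh)
    rwa [hgh, add_sub_cancel_right] at this
  refine hs ?_
  have := W.smul_mem a⁻¹ h1
  rwa [inv_smul_smul₀ ha] at this

/-- The elements of `G` with signature of degree zero are independent modulo `M J`, because they
appear at different steps of the signature filtration, all of them above `M J`. -/
theorem IsSignedStandardBasis.linearIndependent (hψ : IsBasicPresentation ψ)
    (hlt : IsMonomialOrder lt) (hltF : IsCompatibleOrder ltF)
    (hltE : IsCompatibleFreeOrder lt ltE) (hneg : IsNegativeDegreeOrder ltE)
    (hG : IsSignedStandardBasis gen ltF ltE G) (hred : IsInterreduced ltF ltE G) :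
    LinearIndependent K (fun g : degreeZero G => (degSpan ψ gen 1).mkQ g.1.1) := by
  classical
  have := hltE.total
  rw [linearIndependent_iff']
  intro S a hsum
  have hmem : ∑ g ∈ S, a g • g.1.1 ∈ degSpan ψ gen 1 := by
    rw [← Submodule.ker_mkQ (degSpan ψ gen 1), LinearMap.mem_ker, map_sum]
    simpa only [map_smul] using hsum
  by_contra hne
  push Not at hne
  obtain ⟨g₁, hg₁, ha₁⟩ := hne
  -- Compare the terms with the one of greatest signature.
  obtain ⟨_, ⟨g, ⟨hgS, hga⟩, rfl⟩, hmax⟩ := exists_least (Function.swap ltE)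
    (S := (fun g : degreeZero G => g.1.2) '' {g | g ∈ S ∧ a g ≠ 0})
    ((S.finite_toSet.subset fun g hg => hg.1).image _) ⟨_, g₁, ⟨hg₁, ha₁⟩, rfl⟩
  have hrest : ∑ g' ∈ S.erase g, a g' • g'.1.1 ∈ evSpan ψ gen (below ltE g.1.2) := by
    refine Submodule.sum_mem _ fun g' hg' => ?_
    rw [Finset.mem_erase] at hg'
    by_cases ha' : a g' = 0
    · rw [ha', zero_smul]
      exact zero_mem _
    · refine Submodule.smul_mem _ _ (evSpan_mono ?_
        (mem_upTo_of_mem_signed (hG.signed g'.2.1)))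
      have hlt' : ltE g'.1.2 g.1.2 := by
        refine (hmax _ ⟨g', ⟨hg'.2, ha'⟩, rfl⟩).resolve_left fun he => hg'.1 ?_
        exact Subtype.ext (hG.signature_injOn hψ hlt hltF hltE hred g'.2.1 g.2.1 he)
      rintro t (rfl | ht)
      · exact hlt'
      · exact _root_.trans ht hlt'
  have hg : a g • g.1.1 ∈ evSpan ψ gen (below ltE g.1.2) := by
    rw [← Finset.add_sum_erase S _ hgS] at hmem
    have := sub_mem (degSpan_one_le_below hneg g.2.2 hmem) hrest
    rwa [add_sub_cancel_right] at this
  have hg' := Submodule.smul_mem _ (a g)⁻¹ hg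
  rw [inv_smul_smul₀ hga] at hg'
  exact hG.notMem_below hψ hlt hltF hltE hred g.2.1 hg'

end DegreeZero

end SignedStd

end

theorem mainTheorem5 {K V A : Type*} [Field K] [Quiver V] [Fintype V]
    [∀ a b : V, Finite (a ⟶ b)] [Ring A] [Algebra K A]
    (ψ : SignedStd.PathAlgebra K V →ₐ[K] A) (hψ : SignedStd.IsBasicPresentation ψ)
    (lt : SignedStd.PathMon V → SignedStd.PathMon V → Prop)
    (hlt : SignedStd.IsMonomialOrder lt)
    (r m : ℕ) (gen : Fin m → Fin r → A) (M : Submodule Aᵐᵒᵖ (Fin r → A))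
    (hM : M = Submodule.span Aᵐᵒᵖ (Set.range gen))
    (ltF : Fin r × SignedStd.StdMon lt ψ → Fin r × SignedStd.StdMon lt ψ → Prop)
    (hltF : SignedStd.IsCompatibleOrder ltF)
    (ltE : Fin m × SignedStd.PathMon V → Fin m × SignedStd.PathMon V → Prop)
    (hltE : SignedStd.IsCompatibleFreeOrder lt ltE)
    (hneg : SignedStd.IsNegativeDegreeOrder ltE)
    (G : Set ((Fin r → A) × (Fin m × SignedStd.PathMon V)))
    (hG : SignedStd.IsSignedStandardBasis gen ltF ltE G)
    (hred : SignedStd.IsInterreduced ltF ltE G) :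
    Submodule.span Aᵐᵒᵖ (Prod.fst '' SignedStd.degreeZero G) = M ∧
    (∃ B : Module.Basis (SignedStd.degreeZero G) K (M ⧸ Module.jacobson Aᵐᵒᵖ M),
      ∀ g : SignedStd.degreeZero G, ∃ h : g.1.1 ∈ M, B g = Submodule.Quotient.mk ⟨g.1.1, h⟩) ∧
    ((∀ f ∈ Prod.fst '' SignedStd.degreeZero G, SignedStd.IsUniform ψ f) →
      ∀ T : Set (Fin r → A), T ⊂ Prod.fst '' SignedStd.degreeZero G →
        Submodule.span Aᵐᵒᵖ T ≠ M) := by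
  open SignedStd in
  have hM' : ∀ f, f ∈ M ↔ f ∈ degSpan ψ gen 0 := fun f => by rw [hM, mem_span_iff hψ]
  have hGM : ∀ g ∈ G, g.1 ∈ degSpan ψ gen 0 := fun g hg =>
    evSpan_mono (fun _ _ => Nat.zero_le _) (mem_upTo_of_mem_signed (hG.signed hg))
  have hsup := hG.degSpan_zero_le_sup hψ hlt hltF hltE hred
  have hli := hG.linearIndependent hψ hlt hltF hltE hneg hred
  refine ⟨le_antisymm (Submodule.span_le.2 ?_) fun f hf => ?_, ?_, fun huni T hT hTM => ?_⟩
  · rintro _ ⟨g, hg, rfl⟩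
    exact (hM' _).2 (hGM g hg.1)
  · refine degSpan_zero_le hψ (U := Submodule.span Aᵐᵒᵖ (Prod.fst '' degreeZero G))
      (fun f hf => ?_) ((hM' f).1 hf)
    obtain ⟨y, hy, j, hj, rfl⟩ := Submodule.mem_sup.1 (hsup hf)
    exact ⟨y, Submodule.span_le_restrictScalars K Aᵐᵒᵖ _ hy, by rwa [add_sub_cancel_left]⟩
  · let e : degreeZero G → M := fun g => ⟨g.1.1, (hM' _).2 (hGM g.1 g.2.1)⟩
    let q : M →ₗ[K] M ⧸ Module.jacobson Aᵐᵒᵖ M :=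
      (Module.jacobson Aᵐᵒᵖ M).mkQ.restrictScalars K
    have hli' : LinearIndependent K (fun g => q (e g)) := by
      rw [linearIndependent_iff'] at hli ⊢
      intro S a hsum
      refine hli S a ?_
      have h1 : ∑ g ∈ S, a g • e g ∈ Module.jacobson Aᵐᵒᵖ M := by
        rw [← Submodule.Quotient.mk_eq_zero, ← hsum]
        change q _ = _
        rw [map_sum]
        simp only [map_smul]
      have h2 := mem_degSpan_of_mem_jacobson hψ hM' h1
      rw [← Submodule.ker_mkQ (degSpan ψ gen 1), LinearMap.mem_ker] at h2
      rw [← h2]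
      have h3 : (∑ g ∈ S, a g • e g : M).1 = ∑ g ∈ S, a g • g.1.1 := by
        change M.subtype (∑ g ∈ S, a g • e g) = _
        rw [map_sum]
        rfl
      rw [h3, map_sum]
      simp only [map_smul]
    have hsp : ⊤ ≤ Submodule.span K (Set.range fun g => q (e g)) := by
      rintro x -
      obtain ⟨f, rfl⟩ := Submodule.Quotient.mk_surjective _ x
      obtain ⟨y, hy, j, hj, hf⟩ := Submodule.mem_sup.1 (hsup ((hM' _).1 f.2))
      have hspan : Prod.fst '' degreeZero G = (M.subtype.restrictScalars K) '' Set.range e := by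
        rw [← Set.range_comp, Set.image_eq_range]
        rfl
      rw [hspan, Submodule.span_image] at hy
      obtain ⟨y', hy', rfl⟩ := hy
      have hfy : q f = q y' := by
        refine (Submodule.Quotient.eq _).2 (mem_jacobson_of_mem_degSpan hψ hM' (x := f - y') ?_)
        have : (f - y').1 = j := sub_eq_iff_eq_add'.2 hf.symm
        rwa [this]
      change q f ∈ _
      rw [hfy, show (Set.range fun g => q (e g)) = q '' Set.range e from Set.range_comp q e,
        Submodule.span_image]
      exact Submodule.mem_map_of_mem hy'
    exact ⟨Module.Basis.mk hli' hsp, fun g => ⟨(e g).2, Module.Basis.mk_apply hli' hsp g⟩⟩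
  · -- A missing generator would depend on the others modulo `M J`.
    obtain ⟨_, ⟨g, hg, rfl⟩, hgT⟩ := Set.exists_of_ssubset hT
    have hTG : T ⊆ degSpan ψ gen 0 := fun f hf => by
      obtain ⟨g', hg', rfl⟩ := hT.1 hf
      exact hGM g' hg'.1
    have hgM : g.1 ∈ Submodule.span Aᵐᵒᵖ T := hTM ▸ (hM' _).2 (hGM g hg.1)
    obtain ⟨y, hy, j, hj, hyj⟩ := Submodule.mem_sup.1
      (mem_sup_of_mem_span hψ hTG (fun f hf => huni f (hT.1 hf)) hgM)
    refine hli.notMem_span_image (s := {g' | g'.1.1 ∈ T}) (x := ⟨g, hg⟩) hgT ?_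
    have hj0 : (degSpan ψ gen 1).mkQ j = 0 := by
      rwa [← LinearMap.mem_ker, Submodule.ker_mkQ]
    have hq : (degSpan ψ gen 1).mkQ g.1 = (degSpan ψ gen 1).mkQ y := by
      rw [← hyj, map_add, hj0, add_zero]
    change (degSpan ψ gen 1).mkQ g.1 ∈ _
    rw [hq]
    have := Submodule.mem_map_of_mem (f := (degSpan ψ gen 1).mkQ) hy
    rw [← Submodule.span_image] at this
    refine Submodule.span_mono ?_ this
    rintro _ ⟨f, hf, rfl⟩
    obtain ⟨g', hg', rfl⟩ := hT.1 hf
    exact ⟨⟨g', hg'⟩, hf, rfl⟩
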